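/- Let $n>0$ be real and let $S,F$ be real $q\times q$ matrices with $S$ and $V:=S-FSF'$ positive definite. Write $\mathrm{IW}_p(\delta,D)$ ($\delta>0$, $D$ positive definite) for the law on positive definite $p\times p$ matrices with density proportional to $|A|^{-(\delta+2p)/2}\exp(-\tfrac12\operatorname{tr}(DA^{-1}))$, and $N(M,U,C)$ for the matrix normal law with mean $M$, row covariance $U$ and column covariance $C$. The IW-AR(1) process consists of states $\Sigma_0,\Sigma_1,\dots$ and latent blocks $\phi_1,\phi_2,\dots$ ($q\times q$ random matrices) such that, for every $t\ge 1$, $$\begin{pmatrix}\Sigma_{t-1}&\phi_t'\\ \phi_t&\Sigma_t\end{pmatrix}\sim \mathrm{IW}_{2q}\left(n+2,\; n\begin{pmatrix}S&SF'\\ FS&S\end{pmatrix}\right),$$ and, given $\Sigma_0,\dots,\Sigma_{t-1},\phi_1,\dots,\phi_{t-1}$, the conditional law of $(\phi_t,\Sigma_t)$ depends on $\Sigma_{t-1}$ only. Put $\tilde F=SF'S^{-1}$ and $\tilde V=S-SF'S^{-1}FS$. (1) There are random matrices $\tilde\Upsilon_t,\tilde\Psi_t$ ($t\ge1$) such that almost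 surely $$\Sigma_{t-1}=\tilde\Psi_t+\tilde\Upsilon_t\Sigma_t\tilde\Upsilon_t',\qquad \phi_t'=\tilde\Upsilon_t\Sigma_t,$$ where $\tilde\Psi_t\sim \mathrm{IW}_q(n+q+2,n\tilde V)$, $\tilde\Upsilon_t\mid\tilde\Psi_t\sim N(\tilde F,\tilde\Psi_t,(nS)^{-1})$, and $(\tilde\Upsilon_t,\tilde\Psi_t)$ is independent of $(\Sigma_s,\phi_{s+1})_{s\ge t}$. (2) $\tilde F=F$ and $\tilde V=V$ hold if and only if $FS=SF'$. Moreover, (1) holds with $F,V$ in place of $\tilde F,\tilde V$, that is, the reverse-time process follows the same model as the forward-time process, if and only if $FS=SF'$. (3) The process is time-reversible if and only if $FS=SF'$. Here time-reversible means that for every $T$ the reverse-time process, with states $\Sigma_T,\dots,\Sigma_0$ and latent blocks $\phi_T',\dots,\phi_1'$, has the same law as the forward-time process with states $\Sigma_0,\dots,\Sigma_T$ and latent blocks $\phi_1,\dots,\phi_T$. In particular, if $FS=SF'$, then $(\Sigma_T,\dots,\Sigma_0)$ and $(\Sigma_0,\dots,\Sigma_T)$ have the same law for every $T$. -/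

import Mathlib

open MeasureTheory ProbabilityTheory
open scoped Matrix ENNReal

noncomputable section

namespace IWAR

/-- The product sigma-algebra (the Borel one) on matrices. -/
instance instMeasurableSpaceMatrix {ι κ : Type*} : MeasurableSpace (Matrix ι κ ℝ) :=
  inferInstanceAs (MeasurableSpace (ι → κ → ℝ))

instance instStandardBorelSpaceMatrix {ι κ : Type*} [Countable ι] [Countable κ] :
    StandardBorelSpace (Matrix ι κ ℝ) :=
  inferInstanceAs (StandardBorelSpace (ι → κ → ℝ))

/-- The probability measure proportional to a measure `ν` of finite nonzero mass. -/
def normalized {α : Type*} [MeasurableSpace α] (ν : Measure α) : Measure α :=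
  (ν Set.univ)⁻¹ • ν

/-- The symmetric matrix with free entries `x s(i, j)`, `i ≤ j`. Unordered pairs of indices
parametrize the distinct entries of a symmetric matrix, so that `volume` on `Sym2 ι → ℝ`
is Lebesgue measure `∏_{i ≤ j} dA i j` on symmetric matrices. -/
def symMatrix {ι : Type*} (x : Sym2 ι → ℝ) : Matrix ι ι ℝ :=
  Matrix.of fun i j => x s(i, j)

open Classical in
/-- The inverse Wishart law `IW_p(δ, D)` on `p × p` matrices, `p = card ι`, with `δ > 0` degrees of
freedom and positive definite scale `D`: the density with respect to Lebesgue measure on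
symmetric matrices is proportional to `|A|^{-(δ + 2p)/2} exp(- tr(D A⁻¹)/2)` on the positive
definite `A`, and is zero elsewhere. In this parametrization the mean is `D / (δ - 2)` for `δ > 2`,
and for `p = 1` it is the inverse gamma law `IG(δ/2, D/2)`. -/
def invWishart {ι : Type*} [Fintype ι] [DecidableEq ι] (δ : ℝ) (D : Matrix ι ι ℝ) :
    Measure (Matrix ι ι ℝ) :=
  normalized <| Measure.map symMatrix <|
    (volume : Measure (Sym2 ι → ℝ)).withDensity fun x =>
      if (symMatrix x).PosDef then
        ENNReal.ofReal ((symMatrix x).det ^ (-(δ + 2 * (Fintype.card ι : ℝ)) / 2) *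
          Real.exp (-(D * (symMatrix x)⁻¹).trace / 2))
      else 0

/-- The matrix normal law `N(M, U, C)` on `ι × κ` matrices with mean `M`, positive definite row
covariance `U` and column covariance `C` (so `Cov(A i j, A k l) = U i k * C j l`): the density with
respect to Lebesgue measure is proportional to `exp(- tr(C⁻¹ (A - M)' U⁻¹ (A - M))/2)`. -/
def matrixNormal {ι κ : Type*} [Fintype ι] [DecidableEq ι] [Fintype κ] [DecidableEq κ]
    (M : Matrix ι κ ℝ) (U : Matrix ι ι ℝ) (C : Matrix κ κ ℝ) : Measure (Matrix ι κ ℝ) :=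
  normalized <| Measure.map Matrix.of <|
    (volume : Measure (ι → κ → ℝ)).withDensity fun a =>
      ENNReal.ofReal (Real.exp
        (-(C⁻¹ * (Matrix.of a - M)ᵀ * U⁻¹ * (Matrix.of a - M)).trace / 2))

variable {Ω : Type*} [MeasurableSpace Ω] {q : ℕ}

/-- The IW-AR(1) process with parameters `n`, `S`, `F`. Here `Sig t` is the state at time `t` and
`φ t` is the latent off-diagonal block that links `Sig t` and `Sig (t + 1)`. Consecutive states
have the joint law of an inverse Wishart matrix on the augmented space, and the dependence is of
first order: given the history up to time `t`, the pair `(φ t, Sig (t + 1))` depends on `Sig t`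
only. Thus the joint density is
`∏ p(Sig t, φ t, Sig (t + 1)) / ∏ p(Sig t)`, the last product over the interior times. -/
structure IsIWAR (n : ℝ) (S F : Matrix (Fin q) (Fin q) ℝ) (μ : Measure Ω) [IsFiniteMeasure μ]
    (Sig φ : ℕ → Ω → Matrix (Fin q) (Fin q) ℝ) : Prop where
  measurable_state : ∀ t, Measurable (Sig t)
  measurable_latent : ∀ t, Measurable (φ t)
  joint_law : ∀ t,
    μ.map (fun ω => Matrix.fromBlocks (Sig t ω) (φ t ω)ᵀ (φ t ω) (Sig (t + 1) ω)) =
      invWishart (n + 2) (n • Matrix.fromBlocks S (S * Fᵀ) (F * S) S)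
  markov : ∀ t,
    let next : Ω → Matrix (Fin q) (Fin q) ℝ × Matrix (Fin q) (Fin q) ℝ :=
      fun ω => (φ t ω, Sig (t + 1) ω)
    let past : Ω → (Fin (t + 1) → Matrix (Fin q) (Fin q) ℝ) ×
        (Fin t → Matrix (Fin q) (Fin q) ℝ) :=
      fun ω => (fun s => Sig s ω, fun s => φ s ω)
    condDistrib next past μ =ᵐ[μ.map past]
      fun h => condDistrib next (Sig t) μ (h.1 (Fin.last t))

/-- Time reversibility of the IW-AR process, for states and latent blocks together: run backwards from any
time `T`, it has the law of the forward process. Reversing the time of the augmented matrix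
`(Sig t, φ t'; φ t, Sig (t + 1))` swaps its diagonal blocks and transposes the latent block, so the
reverse-time latent blocks are the transposes of the `φ t`, in reverse order. -/
def IsTimeReversible (μ : Measure Ω) (Sig φ : ℕ → Ω → Matrix (Fin q) (Fin q) ℝ) : Prop :=
  ∀ T : ℕ,
    μ.map (fun ω => ((fun i : Fin (T + 1) => Sig i.rev ω), (fun i : Fin T => (φ i.rev ω)ᵀ))) =
      μ.map (fun ω => ((fun i : Fin (T + 1) => Sig i ω), (fun i : Fin T => φ i ω)))

/-- Time reversibility of the law of the states alone. -/
def IsStateReversible (μ : Measure Ω) (Sig : ℕ → Ω → Matrix (Fin q) (Fin q) ℝ) : Prop :=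
  ∀ T : ℕ,
    μ.map (fun ω => fun i : Fin (T + 1) => Sig i.rev ω) =
      μ.map (fun ω => fun i : Fin (T + 1) => Sig i ω)

/-- The reverse-time autoregressive matrix `F̃ = S F' S⁻¹`. -/
def revF (S F : Matrix (Fin q) (Fin q) ℝ) : Matrix (Fin q) (Fin q) ℝ := S * Fᵀ * S⁻¹

/-- The reverse-time innovation scale `Ṽ = S - S F' S⁻¹ F S`. -/
def revV (S F : Matrix (Fin q) (Fin q) ℝ) : Matrix (Fin q) (Fin q) ℝ := S - S * Fᵀ * S⁻¹ * F * S

/-- The innovations `(Υ t, Ψ t)` drive the process backwards with autoregressive matrix `A` and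
innovation scale `W`: almost surely `Sig t = Ψ t + Υ t * Sig (t + 1) * (Υ t)'` with reverse-time
latent block `(φ t)' = Υ t * Sig (t + 1)`, where `Ψ t ∼ IW_q(n + q + 2, n W)`,
`Υ t ∣ Ψ t ∼ N(A, Ψ t, (n S)⁻¹)`, and `(Υ t, Ψ t)` is independent of the process from time `t + 1`
on. -/
structure IsReverseRecursion (n : ℝ) (S A W : Matrix (Fin q) (Fin q) ℝ)
    (μ : Measure Ω) [IsFiniteMeasure μ]
    (Sig φ Υ Ψ : ℕ → Ω → Matrix (Fin q) (Fin q) ℝ) : Prop where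
  measurable_Υ : ∀ t, Measurable (Υ t)
  measurable_Ψ : ∀ t, Measurable (Ψ t)
  latent : ∀ t, ∀ᵐ ω ∂μ, (φ t ω)ᵀ = Υ t ω * Sig (t + 1) ω
  recursion : ∀ t, ∀ᵐ ω ∂μ, Sig t ω = Ψ t ω + Υ t ω * Sig (t + 1) ω * (Υ t ω)ᵀ
  law_Ψ : ∀ t, μ.map (Ψ t) = invWishart (n + q + 2) (n • W)
  law_Υ : ∀ t, condDistrib (Υ t) (Ψ t) μ =ᵐ[μ.map (Ψ t)] fun ψ => matrixNormal A ψ (n • S)⁻¹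
  indep : ∀ t, IndepFun (fun ω => (Υ t ω, Ψ t ω))
    (fun ω => fun s : ℕ => (Sig (t + 1 + s) ω, φ (t + 1 + s) ω)) μ

end IWAR

end

open MeasureTheory ProbabilityTheory
open scoped Matrix ENNReal

noncomputable section

namespace IWAR

/-! ### Measurability of matrix operations and of positive definiteness -/

section Measurability

variable {ι κ : Type*} [Finite ι] [Finite κ]

/-! Everything rests on the block factorization of one inverse Wishart matrix `Z = (a, b; b', c)`.
In the coordinates `c`, `υ = b c⁻¹` and `ψ = a - b c⁻¹ b'` the Jacobian is a power of `|c|`, the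
determinant is `|c| |ψ|`, and completing the square splits `tr(D Z⁻¹)` into a term in `c`, a term in
`ψ` and a Gaussian quadratic form in `υ` with row covariance `ψ`. Hence `(ψ, υ)` is independent of
`c`, with `ψ` inverse Wishart and `υ` matrix normal given `ψ` (`map_schur_invWishart`). No
normalizing constant is evaluated: the joint law is the law of a random matrix, so its total mass
before normalization lies strictly between `0` and `∞`, and this mass is a product, so each factor
does too (`masses_of_isProbabilityMeasure_invWishart`).

For (1), the factorization of the augmented matrix gives the recursion, the laws of the innovations
and their independence of the next state. The innovations are functions of the past of that state,
so the Markov property extends the independence to the whole future (`indepFun_future`).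

For (2), the latent equation forces `Υ t = (φ t)' (Sig (t + 1))⁻¹`, and the recursion then forces `Ψ
t`. Two reverse recursions thus have the same innovations almost surely, and a matrix normal law
determines its mean, so the autoregressive matrix is unique (`reverseRecursion_unique`). It equals
`F` exactly when `S F' S⁻¹ = F`, and the equality of innovation scales follows from this.

For (3), reversing one step swaps the diagonal blocks and replaces the off-diagonal scale `S F'` by
its transpose. The regression mean determines this block (`regression_eq_of_invWishart_eq`), so the
one-step law is symmetric exactly when `F S = S F'`. One step is the case `T = 1`, which gives
necessity; for sufficiency, a stationary Markov chain with symmetric one-step law is reversible over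
every horizon (`map_reversePath`). -/

instance instBorelSpaceMatrix : BorelSpace (Matrix ι κ ℝ) :=
  inferInstanceAs (BorelSpace (ι → κ → ℝ))

instance instSecondCountableTopologyMatrix : SecondCountableTopology (Matrix ι κ ℝ) :=
  inferInstanceAs (SecondCountableTopology (ι → κ → ℝ))

theorem measurable_matrix_iff {α ι κ : Type*} [MeasurableSpace α] {f : α → Matrix ι κ ℝ} :
    Measurable f ↔ ∀ i j, Measurable fun a => f a i j :=
  ⟨fun h i j => (measurable_pi_apply j).comp ((measurable_pi_apply i).comp h),
    fun h => measurable_pi_lambda _ fun i => measurable_pi_lambda _ fun j => h i j⟩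

theorem measurable_matrix_entry {ι κ : Type*} (i : ι) (j : κ) :
    Measurable fun A : Matrix ι κ ℝ => A i j :=
  measurable_matrix_iff.1 measurable_id i j

theorem _root_.Measurable.matrix_mul {α ι κ μ : Type*} [MeasurableSpace α] [Fintype κ]
    {f : α → Matrix ι κ ℝ} {g : α → Matrix κ μ ℝ} (hf : Measurable f) (hg : Measurable g) :
    Measurable fun a => f a * g a := by
  refine measurable_matrix_iff.2 fun i j => ?_
  simp only [Matrix.mul_apply]
  exact Finset.measurable_fun_sum _ fun k _ =>
    (measurable_matrix_iff.1 hf i k).mul (measurable_matrix_iff.1 hg k j)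

theorem _root_.Measurable.matrix_transpose {α ι κ : Type*} [MeasurableSpace α]
    {f : α → Matrix ι κ ℝ} (hf : Measurable f) : Measurable fun a => (f a)ᵀ :=
  measurable_matrix_iff.2 fun i j => measurable_matrix_iff.1 hf j i

theorem _root_.Measurable.matrix_add {α ι κ : Type*} [MeasurableSpace α]
    {f g : α → Matrix ι κ ℝ} (hf : Measurable f) (hg : Measurable g) :
    Measurable fun a => f a + g a :=
  measurable_matrix_iff.2 fun i j =>
    (measurable_matrix_iff.1 hf i j).add (measurable_matrix_iff.1 hg i j)

theorem _root_.Measurable.matrix_sub {α ι κ : Type*} [MeasurableSpace α]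
    {f g : α → Matrix ι κ ℝ} (hf : Measurable f) (hg : Measurable g) :
    Measurable fun a => f a - g a :=
  measurable_matrix_iff.2 fun i j =>
    (measurable_matrix_iff.1 hf i j).sub (measurable_matrix_iff.1 hg i j)

theorem _root_.Measurable.matrix_trace {α ι : Type*} [MeasurableSpace α] [Fintype ι]
    {f : α → Matrix ι ι ℝ} (hf : Measurable f) : Measurable fun a => (f a).trace :=
  Finset.measurable_fun_sum _ fun i _ => measurable_matrix_iff.1 hf i i

theorem _root_.Measurable.matrix_submatrix {α ι κ ι' κ' : Type*} [MeasurableSpace α]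
    {f : α → Matrix ι κ ℝ} (hf : Measurable f) (r : ι' → ι) (c : κ' → κ) :
    Measurable fun a => (f a).submatrix r c :=
  measurable_matrix_iff.2 fun i j => measurable_matrix_iff.1 hf (r i) (c j)

theorem measurable_matrix_det {ι : Type*} [Fintype ι] [DecidableEq ι] :
    Measurable fun A : Matrix ι ι ℝ => A.det :=
  (continuous_id.matrix_det).measurable

theorem measurable_matrix_inv {ι : Type*} [Fintype ι] [DecidableEq ι] :
    Measurable fun A : Matrix ι ι ℝ => A⁻¹ := by
  refine measurable_matrix_iff.2 fun i j => ?_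
  have h : Measurable fun A : Matrix ι ι ℝ => A.adjugate i j :=
    (measurable_matrix_iff.1 (continuous_id.matrix_adjugate).measurable i j)
  -- The adjugate formula also covers singular matrices, where both sides are zero, so no case split
  -- is needed.
  simp only [Matrix.inv_def, Ring.inverse_eq_inv', Matrix.smul_apply, smul_eq_mul]
  exact measurable_matrix_det.inv.mul h

theorem transpose_eq_of_posDef {ι : Type*} {A : Matrix ι ι ℝ} (hA : A.PosDef) : Aᵀ = A := by
  rw [← Matrix.conjTranspose_eq_transpose_of_trivial]
  exact hA.isHermitian

/-- Semidefiniteness is an intersection of closed conditions, so uncountably many test vectors do no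
harm; a nonzero determinant then singles out the definite matrices. -/
theorem measurableSet_posDef {ι : Type*} [Fintype ι] :
    MeasurableSet {A : Matrix ι ι ℝ | A.PosDef} := by
  classical
  have h : {A : Matrix ι ι ℝ | A.PosDef} =
      ({A : Matrix ι ι ℝ | Aᵀ = A} ∩ ⋂ x : ι → ℝ, {A | 0 ≤ x ⬝ᵥ (A *ᵥ x)}) ∩ {A | A.det ≠ 0} := by
    ext A
    simp only [Set.mem_inter_iff, Set.mem_ofPred_eq, Set.mem_iInter]
    constructor
    · intro hA
      exact ⟨⟨transpose_eq_of_posDef hA, fun x => by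
        simpa using hA.posSemidef.dotProduct_mulVec_nonneg x⟩, hA.det_pos.ne'⟩
    · rintro ⟨⟨h1, h2⟩, h3⟩
      have : A.PosSemidef := .of_dotProduct_mulVec_nonneg (by simpa [Matrix.IsHermitian] using h1)
        fun x => by simpa using h2 x
      exact this.posDef_iff_det_ne_zero.2 h3
  rw [h]
  refine ((isClosed_eq (by fun_prop) continuous_id).inter
    (isClosed_iInter fun x => isClosed_le continuous_const ?_)).measurableSet.inter
    (measurable_matrix_det (measurableSet_singleton 0).compl)
  exact continuous_const.dotProduct (continuous_id.matrix_mulVec continuous_const)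

end Measurability

/-! ### Schur complements and regression coordinates -/

section Block

variable {ι κ : Type*} [Fintype ι] [DecidableEq ι] [Fintype κ] [DecidableEq κ]

/-- The Schur criterion for semidefiniteness becomes one for definiteness because the determinant is
the product of those of `C` and of the Schur complement. -/
theorem posDef_fromBlocks_iff {A : Matrix ι ι ℝ} {B : Matrix ι κ ℝ} {C : Matrix κ κ ℝ} :
    (Matrix.fromBlocks A B Bᵀ C).PosDef ↔ C.PosDef ∧ (A - B * C⁻¹ * Bᵀ).PosDef := by
  by_cases hC : C.PosDef
  · have : Invertible C := hC.isUnit.invertible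
    have hdet := Matrix.det_fromBlocks₂₂ A B Bᵀ C
    have hiff := Matrix.PosDef.fromBlocks₂₂ A B hC
    rw [Matrix.conjTranspose_eq_transpose_of_trivial] at hiff
    rw [Matrix.invOf_eq_nonsing_inv] at hdet
    simp only [hC, true_and]
    constructor
    · intro h
      refine (hiff.1 h.posSemidef).posDef_iff_det_ne_zero.2 fun h0 => h.det_pos.ne' ?_
      rw [hdet, h0, mul_zero]
    · intro h
      refine (hiff.2 h.posSemidef).posDef_iff_det_ne_zero.2 ?_
      rw [hdet]
      exact mul_ne_zero hC.det_pos.ne' h.det_pos.ne'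
  · simp only [hC, false_and, iff_false]
    intro h
    exact hC (h.submatrix (e := Sum.inr) Sum.inr_injective)

omit [DecidableEq ι] [DecidableEq κ] in
theorem trace_fromBlocks (A : Matrix ι ι ℝ) (B : Matrix ι κ ℝ) (C : Matrix κ ι ℝ)
    (D : Matrix κ κ ℝ) : (Matrix.fromBlocks A B C D).trace = A.trace + D.trace := by
  simp [Matrix.trace, Fintype.sum_sum_type]

variable {ψ : Matrix ι ι ℝ} {υ : Matrix ι κ ℝ} {c : Matrix κ κ ℝ}

omit [Fintype ι] [DecidableEq ι] in
theorem schur_compl_regression (hc : c.PosDef) :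
    ψ + υ * c * υᵀ - υ * c * c⁻¹ * (υ * c)ᵀ = ψ := by
  have hct : cᵀ = c := transpose_eq_of_posDef hc
  rw [Matrix.mul_nonsing_inv_cancel_right _ _ hc.det_pos.ne'.isUnit, Matrix.transpose_mul, hct,
    ← Matrix.mul_assoc, add_sub_cancel_right]

theorem posDef_regression_iff (hc : c.PosDef) :
    (Matrix.fromBlocks (ψ + υ * c * υᵀ) (υ * c) (υ * c)ᵀ c).PosDef ↔ ψ.PosDef := by
  rw [posDef_fromBlocks_iff, schur_compl_regression hc, and_iff_right hc]

theorem det_regression (hc : c.PosDef) :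
    (Matrix.fromBlocks (ψ + υ * c * υᵀ) (υ * c) (υ * c)ᵀ c).det = c.det * ψ.det := by
  have : Invertible c := hc.isUnit.invertible
  rw [Matrix.det_fromBlocks₂₂, Matrix.invOf_eq_nonsing_inv, schur_compl_regression hc]

theorem inv_regression (hc : c.PosDef) (hψ : IsUnit ψ.det) :
    (Matrix.fromBlocks (ψ + υ * c * υᵀ) (υ * c) (υ * c)ᵀ c)⁻¹ =
      Matrix.fromBlocks ψ⁻¹ (-(ψ⁻¹ * υ)) (-(υᵀ * ψ⁻¹)) (c⁻¹ + υᵀ * ψ⁻¹ * υ) := by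
  have hct : cᵀ = c := transpose_eq_of_posDef hc
  have hcu : IsUnit c.det := hc.det_pos.ne'.isUnit
  refine Matrix.inv_eq_right_inv ?_
  rw [Matrix.fromBlocks_multiply, ← Matrix.fromBlocks_one, Matrix.transpose_mul, hct]
  have e1 : υ * c * c⁻¹ = υ := Matrix.mul_nonsing_inv_cancel_right _ _ hcu
  congr 1
  · simp only [Matrix.add_mul, Matrix.mul_neg, ← Matrix.mul_assoc, Matrix.mul_nonsing_inv _ hψ]
    abel
  · simp only [Matrix.add_mul, Matrix.mul_add, Matrix.mul_neg, ← Matrix.mul_assoc,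
      Matrix.mul_nonsing_inv _ hψ, e1, Matrix.one_mul]
    abel
  · simp only [Matrix.mul_neg, ← Matrix.mul_assoc]
    abel
  · simp only [Matrix.mul_add, Matrix.mul_neg, ← Matrix.mul_assoc, Matrix.mul_nonsing_inv _ hcu]
    abel

/-- Completing the square in `υ`: the cross terms make `D₁₂ D₂₂⁻¹` the centre of the quadratic form,
and the remainder turns `D₁₁` into its Schur complement. This is the exponent of the factorized
density. -/
theorem trace_regression (hc : c.PosDef) (hψ : IsUnit ψ.det)
    (D₁₁ : Matrix ι ι ℝ) (D₁₂ : Matrix ι κ ℝ) {D₂₂ : Matrix κ κ ℝ} (hD : D₂₂.PosDef) :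
    (Matrix.fromBlocks D₁₁ D₁₂ D₁₂ᵀ D₂₂ *
      (Matrix.fromBlocks (ψ + υ * c * υᵀ) (υ * c) (υ * c)ᵀ c)⁻¹).trace =
      (D₂₂ * c⁻¹).trace + ((D₁₁ - D₁₂ * D₂₂⁻¹ * D₁₂ᵀ) * ψ⁻¹).trace +
        (D₂₂ * (υ - D₁₂ * D₂₂⁻¹)ᵀ * ψ⁻¹ * (υ - D₁₂ * D₂₂⁻¹)).trace := by
  have hDt : D₂₂ᵀ = D₂₂ := transpose_eq_of_posDef hD
  have hDu : IsUnit D₂₂.det := hD.det_pos.ne'.isUnit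
  rw [inv_regression hc hψ, Matrix.fromBlocks_multiply, trace_fromBlocks]
  have e1 : D₂₂ * (D₁₂ * D₂₂⁻¹)ᵀ = D₁₂ᵀ := by
    rw [Matrix.transpose_mul, Matrix.transpose_nonsing_inv, hDt, ← Matrix.mul_assoc,
      Matrix.mul_nonsing_inv _ hDu, Matrix.one_mul]
  have e2 : (D₂₂ * υᵀ * ψ⁻¹ * (D₁₂ * D₂₂⁻¹)).trace = (D₁₂ * υᵀ * ψ⁻¹).trace := by
    rw [← Matrix.mul_assoc, Matrix.trace_mul_comm, ← Matrix.mul_assoc, ← Matrix.mul_assoc,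
      ← Matrix.mul_assoc, Matrix.nonsing_inv_mul _ hDu, Matrix.one_mul, Matrix.trace_mul_comm,
      ← Matrix.mul_assoc]
  have e3 : (D₁₂ᵀ * ψ⁻¹ * (D₁₂ * D₂₂⁻¹)).trace = (D₁₂ * D₂₂⁻¹ * D₁₂ᵀ * ψ⁻¹).trace := by
    rw [Matrix.trace_mul_comm, ← Matrix.mul_assoc]
  rw [Matrix.transpose_sub, Matrix.mul_sub D₂₂, e1]
  simp only [Matrix.mul_add, Matrix.mul_sub, Matrix.sub_mul, Matrix.mul_neg, ← Matrix.mul_assoc,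
    Matrix.trace_add, Matrix.trace_sub, Matrix.trace_neg]
  rw [← Matrix.mul_assoc] at e2 e3
  rw [e2, e3]
  ring

end Block

/-! ### Lebesgue measure on matrices and linear changes of variables -/

/-- Lebesgue measure on symmetric matrices. -/
def symVolume (ι : Type*) [Fintype ι] : Measure (Matrix ι ι ℝ) :=
  Measure.map symMatrix (volume : Measure (Sym2 ι → ℝ))

/-- Lebesgue measure on matrices. -/
def matVolume (ι κ : Type*) [Fintype ι] [Fintype κ] : Measure (Matrix ι κ ℝ) :=
  Measure.map Matrix.of (volume : Measure (ι → κ → ℝ))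

theorem measurable_symMatrix {ι : Type*} : Measurable (symMatrix : (Sym2 ι → ℝ) → Matrix ι ι ℝ) :=
  measurable_matrix_iff.2 fun i j => measurable_pi_apply s(i, j)

theorem measurable_matrix_of {ι κ : Type*} :
    Measurable (Matrix.of : (ι → κ → ℝ) → Matrix ι κ ℝ) := measurable_id

section

variable {ι κ : Type*} [Fintype ι] [Fintype κ]

instance : SFinite (symVolume ι) := by unfold symVolume; infer_instance

theorem matVolume_eq : matVolume ι κ = (volume : Measure (ι → κ → ℝ)) := Measure.map_id

instance : SigmaFinite (matVolume ι κ) := by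
  have h : SigmaFinite (volume : Measure (ι → κ → ℝ)) := inferInstance
  rw [matVolume_eq]
  exact h

theorem lintegral_symVolume {g : Matrix ι ι ℝ → ℝ≥0∞} (hg : Measurable g) :
    ∫⁻ A, g A ∂symVolume ι = ∫⁻ x, g (symMatrix x) := lintegral_map hg measurable_symMatrix

theorem lintegral_matVolume {g : Matrix ι κ ℝ → ℝ≥0∞} :
    ∫⁻ A, g A ∂matVolume ι κ = ∫⁻ x : ι → κ → ℝ, g (Matrix.of x) := by rw [matVolume_eq]; rfl

theorem lintegral_symVolume_add {g : Matrix ι ι ℝ → ℝ≥0∞} (hg : Measurable g) {s : Matrix ι ι ℝ}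
    (hs : sᵀ = s) : ∫⁻ A, g (A + s) ∂symVolume ι = ∫⁻ A, g A ∂symVolume ι := by
  have hsym (i j : ι) : s i j = s j i := congrFun (congrFun hs.symm i) j
  let y : Sym2 ι → ℝ := Sym2.lift ⟨fun i j => s i j, hsym⟩
  have hy : ∀ x, symMatrix x + s = symMatrix (x + y) := fun x => by
    ext i j
    simp [symMatrix, y]
  have hgs : Measurable fun A => g (A + s) := hg.comp (measurable_id.matrix_add measurable_const)
  rw [lintegral_symVolume hg, lintegral_symVolume hgs]
  simp only [hy]
  exact lintegral_add_right_eq_self (fun x => g (symMatrix x)) y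

theorem lintegral_matVolume_add {g : Matrix ι κ ℝ → ℝ≥0∞} (s : Matrix ι κ ℝ) :
    ∫⁻ A, g (A + s) ∂matVolume ι κ = ∫⁻ A, g A ∂matVolume ι κ := by
  rw [lintegral_matVolume, lintegral_matVolume]
  exact lintegral_add_right_eq_self (fun x : ι → κ → ℝ => g (Matrix.of x)) (Matrix.of.symm s)

/-- Uncurrying in either order of the indices gives the same product measure on functions on `ι ×
κ`. -/
theorem map_transpose_matVolume :
    Measure.map Matrix.transpose (matVolume ι κ) = matVolume κ ι := by
  let e₁ : (ι → κ → ℝ) → (ι × κ → ℝ) := fun b p => b p.1 p.2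
  let e₂ : (κ → ι → ℝ) → (ι × κ → ℝ) := fun b p => b p.2 p.1
  let r : (ι × κ → ℝ) → (κ → ι → ℝ) := fun f k i => f (i, k)
  have he₁ : Measurable e₁ := measurable_pi_lambda _ fun p => by fun_prop
  have he₂ : Measurable e₂ := measurable_pi_lambda _ fun p => by fun_prop
  have hr : Measurable r := by fun_prop
  have h₁ : Measure.map e₁ volume = volume := by
    refine (Measure.pi_eq fun s hs => ?_).symm
    have : e₁ ⁻¹' Set.univ.pi s = Set.univ.pi fun i => Set.univ.pi fun k => s (i, k) := by
      ext b; simp [e₁, Set.mem_pi]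
    rw [Measure.map_apply he₁ (.univ_pi hs), this]
    simp only [Fintype.prod_prod_type, volume_pi, Measure.pi_pi]
  have h₂ : Measure.map e₂ volume = volume := by
    refine (Measure.pi_eq fun s hs => ?_).symm
    have : e₂ ⁻¹' Set.univ.pi s = Set.univ.pi fun k => Set.univ.pi fun i => s (i, k) := by
      ext b; simp only [e₂, Set.mem_pi, Set.mem_preimage, Prod.forall, Set.mem_univ, true_imp_iff]
      exact forall_comm
    rw [Measure.map_apply he₂ (.univ_pi hs), this]
    simp only [Fintype.prod_prod_type_right, volume_pi, Measure.pi_pi]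
  have ht : Measurable (Matrix.transpose : Matrix ι κ ℝ → Matrix κ ι ℝ) :=
    measurable_id.matrix_transpose
  calc Measure.map Matrix.transpose (matVolume ι κ)
      = Measure.map Matrix.of (Measure.map r (Measure.map e₁ volume)) := by
        rw [Measure.map_map hr he₁, matVolume, Measure.map_map ht measurable_matrix_of,
          Measure.map_map measurable_matrix_of (hr.comp he₁)]
        rfl
    _ = Measure.map Matrix.of (Measure.map r (Measure.map e₂ volume)) := by rw [h₁, h₂]
    _ = matVolume κ ι := by
        rw [Measure.map_map hr he₂, Measure.map_map measurable_matrix_of (hr.comp he₂)]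
        rfl

theorem lintegral_matVolume_transpose {g : Matrix κ ι ℝ → ℝ≥0∞} (hg : Measurable g) :
    ∫⁻ A, g Aᵀ ∂matVolume ι κ = ∫⁻ A, g A ∂matVolume κ ι := by
  have ht : Measurable (Matrix.transpose : Matrix ι κ ℝ → Matrix κ ι ℝ) :=
    measurable_id.matrix_transpose
  rw [← map_transpose_matVolume (ι := ι) (κ := κ), lintegral_map hg ht]

variable [DecidableEq ι] [DecidableEq κ]

-- Right multiplication by `c` acts on each row separately through `cᵀ`, so every one of the `card
-- ι` rows contributes a factor `|det c|⁻¹`.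
omit [DecidableEq ι] in
theorem map_mul_right_matVolume {c : Matrix κ κ ℝ} (hc : c.det ≠ 0) :
    Measure.map (fun A => A * c) (matVolume ι κ) =
      ENNReal.ofReal |c.det⁻¹| ^ Fintype.card ι • matVolume ι κ := by
  have hd : cᵀ.det ≠ 0 := by rwa [Matrix.det_transpose]
  have hm : Measurable (Matrix.toLin' cᵀ) := (LinearMap.continuous_on_pi _).measurable
  let f : (ι → κ → ℝ) → ι → κ → ℝ := fun b i => Matrix.toLin' cᵀ (b i)
  have hf : Measurable f := measurable_pi_lambda _ fun i => hm.comp (measurable_pi_apply i)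
  have hfun : (fun A : Matrix ι κ ℝ => A * c) ∘ Matrix.of = Matrix.of ∘ f := by
    funext A
    ext i j
    simp [f, Matrix.mul_apply, Matrix.toLin'_apply, Matrix.mulVec, dotProduct, mul_comm]
  have hσ : SigmaFinite (Measure.map (Matrix.toLin' cᵀ) volume) := by
    rw [Real.map_matrix_volume_pi_eq_smul_volume_pi hd]
    exact inferInstanceAs (SigmaFinite (Real.toNNReal _ • volume))
  have hpi : Measure.map f volume = ENNReal.ofReal |c.det⁻¹| ^ Fintype.card ι • volume := by
    have h : Measure.map f volume = Measure.pi fun _ => Measure.map (Matrix.toLin' cᵀ) volume :=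
      Measure.pi_map_pi (hμ := fun _ => hσ) fun _ => hm.aemeasurable
    rw [h]
    refine Measure.pi_eq fun s _ => ?_
    rw [Real.map_matrix_volume_pi_eq_smul_volume_pi hd, Matrix.det_transpose]
    simp [Finset.prod_mul_distrib, volume_pi_pi]
  have hmul : Measurable fun A : Matrix ι κ ℝ => A * c := measurable_id.matrix_mul measurable_const
  rw [matVolume, Measure.map_map hmul measurable_matrix_of, hfun,
    ← Measure.map_map measurable_matrix_of hf, hpi, Measure.map_smul]

omit [DecidableEq ι] in
theorem lintegral_matVolume_mul_right {c : Matrix κ κ ℝ} (hc : c.det ≠ 0)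
    {g : Matrix ι κ ℝ → ℝ≥0∞} (hg : Measurable g) :
    ∫⁻ A, g A ∂matVolume ι κ =
      ENNReal.ofReal |c.det| ^ Fintype.card ι * ∫⁻ A, g (A * c) ∂matVolume ι κ := by
  have hm : Measurable fun A : Matrix ι κ ℝ => A * c := measurable_id.matrix_mul measurable_const
  have h := lintegral_map (μ := matVolume ι κ) hg hm
  rw [map_mul_right_matVolume hc, lintegral_smul_measure, smul_eq_mul] at h
  rw [← h, ← mul_assoc, ← mul_pow, ← ENNReal.ofReal_mul (abs_nonneg _), ← abs_mul,
    mul_inv_cancel₀ hc]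
  simp

omit [DecidableEq κ] in
theorem lintegral_matVolume_mul_left {r : Matrix ι ι ℝ} (hr : r.det ≠ 0)
    {g : Matrix ι κ ℝ → ℝ≥0∞} (hg : Measurable g) :
    ∫⁻ A, g A ∂matVolume ι κ =
      ENNReal.ofReal |r.det| ^ Fintype.card κ * ∫⁻ A, g (r * A) ∂matVolume ι κ := by
  have ht : Measurable fun A : Matrix κ ι ℝ => g Aᵀ := hg.comp measurable_id.matrix_transpose
  have hl : Measurable fun A : Matrix ι κ ℝ => g (r * A) :=
    hg.comp (measurable_const.matrix_mul measurable_id)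
  rw [← lintegral_matVolume_transpose hg, lintegral_matVolume_mul_right (c := rᵀ)
    (by rwa [Matrix.det_transpose]) ht, Matrix.det_transpose, ← lintegral_matVolume_transpose hl]
  simp [Matrix.transpose_mul]

/-- Unordered pairs in a disjoint union. -/
def sym2Sum (ι κ : Type*) : Sym2 κ ⊕ (ι × κ) ⊕ Sym2 ι → Sym2 (ι ⊕ κ) :=
  Sum.elim (Sym2.map Sum.inr) (Sum.elim (fun p => s(Sum.inl p.1, Sum.inr p.2)) (Sym2.map Sum.inl))

theorem sym2Sum_bijective (ι κ : Type*) : Function.Bijective (sym2Sum ι κ) := by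
  constructor
  · rintro (a | a | a) (b | b | b) h
    · exact congrArg _ (Sym2.map.injective Sum.inr_injective h)
    · induction a with | _ i j => simp [sym2Sum] at h
    · induction a with | _ i j => induction b with | _ k l => simp [sym2Sum] at h
    · induction b with | _ i j => simp [sym2Sum] at h
    · simp [sym2Sum] at h
      simp [Prod.ext_iff, h]
    · induction b with | _ i j => simp [sym2Sum] at h
    · induction a with | _ i j => induction b with | _ k l => simp [sym2Sum] at h
    · induction a with | _ i j => simp [sym2Sum] at h
    · exact congrArg _ (congrArg _ (Sym2.map.injective Sum.inl_injective h))
  · intro z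
    induction z with | _ i j =>
    rcases i with i | i <;> rcases j with j | j
    · exact ⟨.inr (.inr s(i, j)), rfl⟩
    · exact ⟨.inr (.inl (i, j)), rfl⟩
    · exact ⟨.inr (.inl (j, i)), Sym2.eq_swap⟩
    · exact ⟨.inl s(i, j), rfl⟩

-- Tonelli for the distinct entries. The order, with `c` outermost and `a` innermost, allows `b` to
-- be rescaled by `c` and `a` to be shifted by a function of `b` and `c`.
omit [DecidableEq ι] [DecidableEq κ] in
theorem lintegral_symVolume_sum {g : Matrix (ι ⊕ κ) (ι ⊕ κ) ℝ → ℝ≥0∞} (hg : Measurable g) :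
    ∫⁻ Z, g Z ∂symVolume (ι ⊕ κ) =
      ∫⁻ c, ∫⁻ b, ∫⁻ a, g (Matrix.fromBlocks a b bᵀ c) ∂symVolume ι ∂matVolume ι κ
        ∂symVolume κ := by
  let e := Equiv.ofBijective _ (sym2Sum_bijective ι κ)
  let Φ : (Sym2 κ → ℝ) × (ι → κ → ℝ) × (Sym2 ι → ℝ) → Sym2 (ι ⊕ κ) → ℝ := fun p w =>
    Sum.elim p.1 (Sum.elim (fun q => p.2.1 q.1 q.2) p.2.2) (e.symm w)
  have hΦm : Measurable Φ := by
    refine measurable_pi_lambda _ fun w => ?_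
    rcases h : e.symm w with z | z | z <;> simp only [Φ, h, Sum.elim_inl, Sum.elim_inr]
    all_goals fun_prop
  have hΦ : Measure.map Φ volume = volume := by
    refine (Measure.pi_eq fun s hs => ?_).symm
    have : Φ ⁻¹' Set.univ.pi s = (Set.univ.pi fun z => s (e (.inl z))) ×ˢ
        (Set.univ.pi fun i => Set.univ.pi fun k => s (e (.inr (.inl (i, k))))) ×ˢ
        (Set.univ.pi fun z => s (e (.inr (.inr z)))) := by
      ext p
      simp only [Set.mem_preimage, Set.mem_pi, Set.mem_univ, true_imp_iff, Set.mem_prod, Φ]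
      rw [← e.forall_congr_right (q := fun w => _ ∈ s w)]
      simp [Sum.forall]
    rw [Measure.map_apply hΦm (.univ_pi hs), this, Measure.volume_eq_prod, Measure.prod_prod,
      Measure.volume_eq_prod, Measure.prod_prod, ← e.prod_comp]
    simp [Fintype.prod_sum_type, Fintype.prod_prod_type, volume_pi, Measure.pi_pi]
  have hs : ∀ p, symMatrix (Φ p) =
      Matrix.fromBlocks (symMatrix p.2.2) (Matrix.of p.2.1) (Matrix.of p.2.1)ᵀ
        (symMatrix p.1) := by
    have e1 : ∀ i j, e.symm s(Sum.inr i, Sum.inr j) = .inl s(i, j) := fun i j =>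
      e.symm_apply_eq.2 rfl
    have e2 : ∀ i j, e.symm s(Sum.inl i, Sum.inr j) = .inr (.inl (i, j)) := fun i j =>
      e.symm_apply_eq.2 rfl
    have e3 : ∀ i j, e.symm s(Sum.inr j, Sum.inl i) = .inr (.inl (i, j)) := fun i j =>
      e.symm_apply_eq.2 Sym2.eq_swap
    have e4 : ∀ i j, e.symm s(Sum.inl i, Sum.inl j) = .inr (.inr s(i, j)) := fun i j =>
      e.symm_apply_eq.2 rfl
    intro p
    ext (i | i) (j | j) <;> simp [symMatrix, Φ, e1, e2, e3, e4]
  have hblk : Measurable fun q : Matrix κ κ ℝ × Matrix ι κ ℝ × Matrix ι ι ℝ =>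
      g (Matrix.fromBlocks q.2.2 q.2.1 q.2.1ᵀ q.1) := by
    refine hg.comp (measurable_matrix_iff.2 ?_)
    rintro (i | i) (j | j)
    · exact (measurable_matrix_entry i j).comp measurable_snd.snd
    · exact (measurable_matrix_entry i j).comp measurable_snd.fst
    · exact (measurable_matrix_entry j i).comp measurable_snd.fst
    · exact (measurable_matrix_entry i j).comp measurable_fst
  have hprod : Measure.map (Prod.map symMatrix (Prod.map Matrix.of symMatrix))
      (volume : Measure ((Sym2 κ → ℝ) × (ι → κ → ℝ) × (Sym2 ι → ℝ))) =
      (symVolume κ).prod ((matVolume ι κ).prod (symVolume ι)) := by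
    rw [Measure.volume_eq_prod, Measure.volume_eq_prod, symVolume, symVolume, matVolume,
      Measure.map_prod_map _ _ measurable_matrix_of measurable_symMatrix,
      Measure.map_prod_map _ _ measurable_symMatrix
        (measurable_matrix_of.prodMap measurable_symMatrix)]
  have hgs : Measurable fun x => g (symMatrix x) := hg.comp measurable_symMatrix
  rw [lintegral_symVolume hg, ← hΦ, lintegral_map hgs hΦm]
  simp only [hs]
  calc _ = ∫⁻ q, g (Matrix.fromBlocks q.2.2 q.2.1 q.2.1ᵀ q.1)
        ∂((symVolume κ).prod ((matVolume ι κ).prod (symVolume ι))) := by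
        rw [← hprod, lintegral_map hblk (measurable_symMatrix.prodMap
          (measurable_matrix_of.prodMap measurable_symMatrix))]
        rfl
    _ = _ := by
        rw [lintegral_prod _ hblk.aemeasurable]
        refine lintegral_congr fun c => ?_
        have hc : Measurable fun q : Matrix ι κ ℝ × Matrix ι ι ℝ =>
          g (Matrix.fromBlocks q.2 q.1 q.1ᵀ c) := hblk.comp (measurable_const.prodMk measurable_id)
        exact lintegral_prod _ hc.aemeasurable

end

/-! ### Normalization of measures -/

section Normalized

theorem map_withDensity_comp {α β : Type*} [MeasurableSpace α] [MeasurableSpace β] (ν : Measure α)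
    {f : α → β} (hf : Measurable f) {w : β → ℝ≥0∞} (hw : Measurable w) :
    Measure.map f (ν.withDensity fun x => w (f x)) = (Measure.map f ν).withDensity w := by
  ext s hs
  rw [Measure.map_apply hf hs, withDensity_apply _ (hf hs), withDensity_apply _ hs,
    setLIntegral_map hs hw hf]

/-- For mass `0` or `∞` the conventions in `ℝ≥0∞` give the normalized measure total mass `0`. This
is how finiteness of the normalizing constants is obtained without computing them. -/
theorem mass_of_isProbabilityMeasure_normalized {α : Type*} [MeasurableSpace α] {ν : Measure α}
    (h : IsProbabilityMeasure (normalized ν)) : ν Set.univ ≠ 0 ∧ ν Set.univ ≠ ∞ := by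
  have h1 := h.measure_univ
  rw [normalized, Measure.smul_apply, smul_eq_mul] at h1
  constructor
  · intro h0; simp [h0] at h1
  · intro h0; simp [h0] at h1

theorem isProbabilityMeasure_normalized {α : Type*} [MeasurableSpace α] {ν : Measure α}
    (h0 : ν Set.univ ≠ 0) (h1 : ν Set.univ ≠ ∞) : IsProbabilityMeasure (normalized ν) :=
  ⟨by rw [normalized, Measure.smul_apply, smul_eq_mul, ENNReal.inv_mul_cancel h0 h1]⟩

theorem smul_normalized {α : Type*} [MeasurableSpace α] {ν : Measure α}
    (h0 : ν Set.univ ≠ 0) (h1 : ν Set.univ ≠ ∞) : ν Set.univ • normalized ν = ν := by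
  rw [normalized, smul_smul, ENNReal.mul_inv_cancel h0 h1, one_smul]

end Normalized

/-! ### The matrix normal law -/

section Normal

variable {ι κ : Type*} [Fintype ι] [DecidableEq ι] [Fintype κ] [DecidableEq κ]

theorem exists_eq_transpose_mul_self {A : Matrix ι ι ℝ} (hA : A.PosDef) :
    ∃ R : Matrix ι ι ℝ, R.det ≠ 0 ∧ A = Rᵀ * R := by
  open scoped MatrixOrder Matrix.Norms.L2Operator in
  obtain ⟨R, hR⟩ := CStarAlgebra.nonneg_iff_eq_star_mul_self.mp hA.posSemidef.nonneg
  rw [Matrix.star_eq_conjTranspose, Matrix.conjTranspose_eq_transpose_of_trivial] at hR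
  refine ⟨R, fun h => hA.det_pos.ne' ?_, hR⟩
  rw [hR, Matrix.det_mul, h, mul_zero]

/-- The unnormalized density of the matrix normal law. -/
def normalWeight (M : Matrix ι κ ℝ) (U : Matrix ι ι ℝ) (C : Matrix κ κ ℝ) (A : Matrix ι κ ℝ) :
    ℝ≥0∞ :=
  ENNReal.ofReal (Real.exp (-(C⁻¹ * (A - M)ᵀ * U⁻¹ * (A - M)).trace / 2))

theorem measurable_normalWeight (M : Matrix ι κ ℝ) (C : Matrix κ κ ℝ) :
    Measurable fun p : Matrix ι ι ℝ × Matrix ι κ ℝ => normalWeight M p.1 C p.2 := by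
  have h1 : Measurable fun p : Matrix ι ι ℝ × Matrix ι κ ℝ => p.2 - M :=
    measurable_snd.matrix_sub measurable_const
  have h2 : Measurable fun p : Matrix ι ι ℝ × Matrix ι κ ℝ => p.1⁻¹ :=
    measurable_matrix_inv.comp measurable_fst
  have h3 := (((measurable_const (a := C⁻¹)).matrix_mul h1.matrix_transpose).matrix_mul
    h2).matrix_mul h1
  exact (Real.measurable_exp.comp (h3.matrix_trace.neg.div_const 2)).ennreal_ofReal

theorem measurable_normalWeight_right (M : Matrix ι κ ℝ) (U : Matrix ι ι ℝ) (C : Matrix κ κ ℝ) :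
    Measurable (normalWeight M U C) := by
  have h1 : Measurable fun A : Matrix ι κ ℝ => A - M := measurable_id.matrix_sub measurable_const
  have h3 : Measurable fun A : Matrix ι κ ℝ => C⁻¹ * (A - M)ᵀ * U⁻¹ * (A - M) :=
    ((measurable_const.matrix_mul h1.matrix_transpose).matrix_mul measurable_const).matrix_mul h1
  exact (Real.measurable_exp.comp (h3.matrix_trace.neg.div_const 2)).ennreal_ofReal

theorem matrixNormal_eq (M : Matrix ι κ ℝ) (U : Matrix ι ι ℝ) (C : Matrix κ κ ℝ) :
    matrixNormal M U C = normalized ((matVolume ι κ).withDensity (normalWeight M U C)) := by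
  rw [matVolume, ← map_withDensity_comp _ measurable_matrix_of
    (measurable_normalWeight_right M U C)]
  rfl

theorem lintegral_normalWeight_mean (M : Matrix ι κ ℝ) (U : Matrix ι ι ℝ) (C : Matrix κ κ ℝ) :
    ∫⁻ A, normalWeight M U C A ∂matVolume ι κ = ∫⁻ A, normalWeight 0 U C A ∂matVolume ι κ := by
  rw [← lintegral_matVolume_add M]
  simp [normalWeight]

/-- The total mass of the unnormalized matrix normal density with identity row covariance. -/
def normalMass (ι : Type*) [Fintype ι] [DecidableEq ι] (C : Matrix κ κ ℝ) : ℝ≥0∞ :=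
  ∫⁻ A : Matrix ι κ ℝ, normalWeight 0 1 C A ∂matVolume ι κ

/-- Writing `U = R' R` and substituting `R' A` for `A` removes `U` from the exponent. Only this
dependence on `U` matters, since `U` will be the random `Ψ`; the remaining constant stays abstract.
-/
theorem lintegral_normalWeight (M : Matrix ι κ ℝ) {U : Matrix ι ι ℝ} (hU : U.PosDef)
    (C : Matrix κ κ ℝ) :
    ∫⁻ A, normalWeight M U C A ∂matVolume ι κ =
      ENNReal.ofReal (U.det ^ ((Fintype.card κ : ℝ) / 2)) * normalMass ι C := by
  obtain ⟨R, hR, rfl⟩ := exists_eq_transpose_mul_self hU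
  have hRt : Rᵀ.det ≠ 0 := by rwa [Matrix.det_transpose]
  rw [lintegral_normalWeight_mean,
    lintegral_matVolume_mul_left hRt (measurable_normalWeight_right _ _ _), normalMass,
    Matrix.det_mul, Matrix.det_transpose]
  congr 1
  · rw [← ENNReal.ofReal_pow (abs_nonneg _), ← abs_mul_abs_self, ← sq, ← Real.rpow_natCast (_ : ℝ) 2,
      ← Real.rpow_mul (abs_nonneg _), ← Real.rpow_natCast]
    congr 2
    push_cast
    ring
  · refine lintegral_congr fun A => ?_
    simp only [normalWeight, sub_zero, Matrix.transpose_mul, Matrix.transpose_transpose,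
      Matrix.mul_inv_rev, inv_one, Matrix.mul_one]
    have h1 : C⁻¹ * (Aᵀ * R) * (R⁻¹ * Rᵀ⁻¹) * (Rᵀ * A) = C⁻¹ * Aᵀ * A := by
      calc _ = C⁻¹ * Aᵀ * (R * R⁻¹) * (Rᵀ⁻¹ * Rᵀ) * A := by simp only [Matrix.mul_assoc]
        _ = _ := by
          rw [Matrix.mul_nonsing_inv _ hR.isUnit, Matrix.nonsing_inv_mul _ hRt.isUnit,
            Matrix.mul_one, Matrix.mul_one]
    rw [h1]

/-- The matrix normal law as a Markov kernel of the row covariance matrix. -/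
def normalKernel (M : Matrix ι κ ℝ) (C : Matrix κ κ ℝ) : Kernel (Matrix ι ι ℝ) (Matrix ι κ ℝ) :=
  open Classical in
  Kernel.piecewise measurableSet_posDef
    (Kernel.withDensity (Kernel.const _ (matVolume ι κ)) fun U A =>
      (ENNReal.ofReal (U.det ^ ((Fintype.card κ : ℝ) / 2)) * normalMass ι C)⁻¹ *
        normalWeight M U C A)
    -- A default value that keeps the kernel Markov; inverse Wishart laws do not charge matrices
    -- that are not positive definite.
    (Kernel.const _ (Measure.dirac M))

theorem measurable_normalKernel_density (M : Matrix ι κ ℝ) (C : Matrix κ κ ℝ) :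
    Measurable (Function.uncurry fun (U : Matrix ι ι ℝ) (A : Matrix ι κ ℝ) =>
      (ENNReal.ofReal (U.det ^ ((Fintype.card κ : ℝ) / 2)) * normalMass ι C)⁻¹ *
        normalWeight M U C A) := by
  have h : Measurable fun p : Matrix ι ι ℝ × Matrix ι κ ℝ =>
      ENNReal.ofReal (p.1.det ^ ((Fintype.card κ : ℝ) / 2)) * normalMass ι C :=
    ((measurable_matrix_det.comp measurable_fst).pow_const _).ennreal_ofReal.mul_const _
  exact h.inv.mul (measurable_normalWeight M C)

theorem normalKernel_apply (M : Matrix ι κ ℝ) (C : Matrix κ κ ℝ) {U : Matrix ι ι ℝ}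
    (hU : U.PosDef) : normalKernel M C U = matrixNormal M U C := by
  classical
  rw [normalKernel, Kernel.piecewise_apply, if_pos (by exact hU),
    Kernel.withDensity_apply _ (measurable_normalKernel_density M C), Kernel.const_apply,
    matrixNormal_eq, normalized, withDensity_apply _ .univ, Measure.restrict_univ,
    lintegral_normalWeight M hU]
  exact withDensity_smul _ (measurable_normalWeight_right M U C)

theorem isMarkovKernel_normalKernel (M : Matrix ι κ ℝ) {C : Matrix κ κ ℝ}
    (h0 : normalMass ι C ≠ 0) (h1 : normalMass ι C ≠ ∞) : IsMarkovKernel (normalKernel M C) := by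
  refine ⟨fun U => ?_⟩
  by_cases hU : U.PosDef
  · have hpos : 0 < U.det ^ ((Fintype.card κ : ℝ) / 2) := Real.rpow_pos_of_pos hU.det_pos _
    rw [normalKernel_apply M C hU, matrixNormal_eq]
    refine isProbabilityMeasure_normalized ?_ ?_ <;>
      rw [withDensity_apply _ .univ, Measure.restrict_univ, lintegral_normalWeight M hU]
    · exact mul_ne_zero (by simpa using hpos) h0
    · exact ENNReal.mul_ne_top ENNReal.ofReal_ne_top h1
  · classical
    rw [normalKernel, Kernel.piecewise_apply, if_neg (by exact hU), Kernel.const_apply]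
    infer_instance

/-- With `P = R' R` and `Q = T' T` the trace is the squared Frobenius norm of `T X R'`, and `R`, `T`
are invertible. -/
theorem eq_of_trace_quadratic_eq_zero {P : Matrix κ κ ℝ} {Q : Matrix ι ι ℝ} (hP : P.PosDef)
    (hQ : Q.PosDef) {X : Matrix ι κ ℝ} (h : (P * Xᵀ * Q * X).trace = 0) : X = 0 := by
  obtain ⟨R, hR, rfl⟩ := exists_eq_transpose_mul_self hP
  obtain ⟨T, hT, rfl⟩ := exists_eq_transpose_mul_self hQ
  have hRt : Rᵀ.det ≠ 0 := by rwa [Matrix.det_transpose]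
  have h1 : ((T * X * Rᵀ)ᵀ * (T * X * Rᵀ)).trace = 0 := by
    rw [← h, ← Matrix.mul_assoc, Matrix.trace_mul_comm]
    simp only [Matrix.transpose_mul, Matrix.transpose_transpose, Matrix.mul_assoc]
  have h2 : T * X * Rᵀ = 0 := by
    rw [← Matrix.trace_conjTranspose_mul_self_eq_zero_iff,
      Matrix.conjTranspose_eq_transpose_of_trivial, h1]
  calc X = T⁻¹ * T * X * (Rᵀ * Rᵀ⁻¹) := by
        rw [Matrix.nonsing_inv_mul _ hT.isUnit, Matrix.mul_nonsing_inv _ hRt.isUnit,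
          Matrix.one_mul, Matrix.mul_one]
    _ = T⁻¹ * (T * X * Rᵀ) * Rᵀ⁻¹ := by simp only [Matrix.mul_assoc]
    _ = 0 := by rw [h2, Matrix.mul_zero, Matrix.zero_mul]

/-- By translation invariance the normalizing constants agree, so the unnormalized densities agree
almost everywhere, and everywhere by continuity. At `M₁` the first exponent vanishes, hence so does
the second. -/
theorem matrixNormal_mean_injective {M₁ M₂ : Matrix ι κ ℝ} {U : Matrix ι ι ℝ} {C : Matrix κ κ ℝ}
    (hU : U.PosDef) (hC : C.PosDef) (hprob : IsProbabilityMeasure (matrixNormal M₁ U C))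
    (h : matrixNormal M₁ U C = matrixNormal M₂ U C) : M₁ = M₂ := by
  have hm := measurable_normalWeight_right (ι := ι) (κ := κ)
  have hmass : ((matVolume ι κ).withDensity (normalWeight M₁ U C)) Set.univ =
      ((matVolume ι κ).withDensity (normalWeight M₂ U C)) Set.univ := by
    simp only [withDensity_apply _ MeasurableSet.univ, Measure.restrict_univ]
    rw [lintegral_normalWeight_mean M₁, lintegral_normalWeight_mean M₂]
  rw [matrixNormal_eq] at hprob
  obtain ⟨h0, h1⟩ := mass_of_isProbabilityMeasure_normalized hprob
  have hν : (matVolume ι κ).withDensity (normalWeight M₁ U C) =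
      (matVolume ι κ).withDensity (normalWeight M₂ U C) := by
    rw [matrixNormal_eq, matrixNormal_eq] at h
    rw [← smul_normalized h0 h1, h, hmass]
    rw [hmass] at h0 h1
    exact smul_normalized h0 h1
  rw [withDensity_eq_iff_of_sigmaFinite (hm _ _ _).aemeasurable (hm _ _ _).aemeasurable,
    matVolume_eq] at hν
  have hcont : ∀ M : Matrix ι κ ℝ, Continuous fun a : ι → κ → ℝ =>
      normalWeight M U C (Matrix.of a) := fun M => by
    refine ENNReal.continuous_ofReal.comp (Real.continuous_exp.comp ?_)
    have ha : Continuous fun a : ι → κ → ℝ => Matrix.of a - M :=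
      (continuous_id : Continuous fun a : ι → κ → ℝ => a).sub continuous_const
    exact ((((continuous_const.matrix_mul ha.matrix_transpose).matrix_mul
      continuous_const).matrix_mul ha).matrix_trace.neg).div_const 2
  have heq := ((hcont M₁).ae_eq_iff_eq (μ := volume) (hcont M₂)).1 hν
  have hz : normalWeight M₁ U C M₁ = normalWeight M₂ U C M₁ := congrFun heq M₁
  have htr : (C⁻¹ * (M₁ - M₂)ᵀ * U⁻¹ * (M₁ - M₂)).trace = 0 := by
    simp only [normalWeight] at hz
    rw [ENNReal.ofReal_eq_ofReal_iff (Real.exp_pos _).le (Real.exp_pos _).le, Real.exp_eq_exp] at hz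
    rw [sub_self, Matrix.mul_zero, Matrix.trace_zero] at hz
    linarith
  exact sub_eq_zero.1 (eq_of_trace_quadratic_eq_zero hC.inv hU.inv htr)

end Normal

/-! ### Block factorization of the inverse Wishart law -/

section InverseWishart

variable {ι κ : Type*} [Fintype ι] [DecidableEq ι] [Fintype κ] [DecidableEq κ]

open Classical in
/-- The unnormalized density of the inverse Wishart law. -/
def iwWeight (δ : ℝ) (D A : Matrix ι ι ℝ) : ℝ≥0∞ :=
  if A.PosDef then
    ENNReal.ofReal (A.det ^ (-(δ + 2 * (Fintype.card ι : ℝ)) / 2) *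
      Real.exp (-(D * A⁻¹).trace / 2))
  else 0

theorem iwWeight_of_posDef (δ : ℝ) (D : Matrix ι ι ℝ) {A : Matrix ι ι ℝ} (hA : A.PosDef) :
    iwWeight δ D A = ENNReal.ofReal (A.det ^ (-(δ + 2 * (Fintype.card ι : ℝ)) / 2) *
      Real.exp (-(D * A⁻¹).trace / 2)) := if_pos hA

theorem iwWeight_of_not_posDef (δ : ℝ) (D : Matrix ι ι ℝ) {A : Matrix ι ι ℝ} (hA : ¬A.PosDef) :
    iwWeight δ D A = 0 := if_neg hA

theorem measurable_iwWeight (δ : ℝ) (D : Matrix ι ι ℝ) : Measurable (iwWeight δ D) := by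
  classical
  have h : Measurable fun A : Matrix ι ι ℝ => D * A⁻¹ :=
    measurable_const.matrix_mul measurable_matrix_inv
  exact Measurable.ite measurableSet_posDef ((measurable_matrix_det.pow_const _).mul
    (Real.measurable_exp.comp (h.matrix_trace.neg.div_const 2))).ennreal_ofReal measurable_const

theorem invWishart_eq (δ : ℝ) (D : Matrix ι ι ℝ) :
    invWishart δ D = normalized ((symVolume ι).withDensity (iwWeight δ D)) := by
  rw [symVolume, ← map_withDensity_comp _ measurable_symMatrix (measurable_iwWeight δ D)]
  rfl

theorem ae_posDef_invWishart (δ : ℝ) (D : Matrix ι ι ℝ) : ∀ᵐ A ∂invWishart δ D, A.PosDef := by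
  rw [invWishart_eq, normalized]
  refine Measure.ae_smul_measure ?_ _
  rw [ae_withDensity_iff (measurable_iwWeight δ D)]
  refine ae_of_all _ fun A hA => ?_
  by_contra h
  exact hA (iwWeight_of_not_posDef δ D h)

/-- Exponent bookkeeping, with `p = card ι` and `r = card κ`. The Jacobian `|c|^p` turns `-(δ + 2(p
+ r))/2` into `-(δ + 2r)/2`, so `c` keeps `δ` degrees of freedom. For `ψ` the same exponent is `-(δ
+ r + 2p)/2 - r/2`: the degrees of freedom grow by `r`, and `|ψ|^(-r/2)` normalizes the Gaussian
factor. -/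
theorem iwWeight_regression (δ : ℝ) (D₁₁ : Matrix ι ι ℝ) (D₁₂ : Matrix ι κ ℝ)
    {D₂₂ : Matrix κ κ ℝ} (hD : D₂₂.PosDef) {c : Matrix κ κ ℝ} (hc : c.PosDef)
    {ψ : Matrix ι ι ℝ} (hψ : ψ.PosDef) (υ : Matrix ι κ ℝ) :
    ENNReal.ofReal |c.det| ^ Fintype.card ι *
      iwWeight δ (Matrix.fromBlocks D₁₁ D₁₂ D₁₂ᵀ D₂₂)
        (Matrix.fromBlocks (ψ + υ * c * υᵀ) (υ * c) (υ * c)ᵀ c) =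
      iwWeight δ D₂₂ c * (iwWeight (δ + Fintype.card κ) (D₁₁ - D₁₂ * D₂₂⁻¹ * D₁₂ᵀ) ψ *
        ((ENNReal.ofReal (ψ.det ^ ((Fintype.card κ : ℝ) / 2)))⁻¹ *
          normalWeight (D₁₂ * D₂₂⁻¹) ψ D₂₂⁻¹ υ)) := by
  have hcd := hc.det_pos
  have hψd := hψ.det_pos
  rw [iwWeight_of_posDef _ _ hc, iwWeight_of_posDef _ _ hψ,
    iwWeight_of_posDef _ _ ((posDef_regression_iff hc).2 hψ), det_regression hc,
    trace_regression hc hψd.ne'.isUnit D₁₁ D₁₂ hD, normalWeight,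
    Matrix.nonsing_inv_nonsing_inv _ hD.det_pos.ne'.isUnit,
    ← ENNReal.ofReal_inv_of_pos (Real.rpow_pos_of_pos hψd _), ← ENNReal.ofReal_pow (abs_nonneg _),
    ← ENNReal.ofReal_mul (by positivity), ← ENNReal.ofReal_mul (by positivity),
    ← ENNReal.ofReal_mul (by positivity), ← ENNReal.ofReal_mul (by positivity), abs_of_pos hcd,
    ← Real.rpow_natCast, Real.mul_rpow hcd.le hψd.le, ← Real.rpow_neg hψd.le]
  congr 1
  set a := (D₂₂ * c⁻¹).trace
  set b := ((D₁₁ - D₁₂ * D₂₂⁻¹ * D₁₂ᵀ) * ψ⁻¹).trace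
  set d := (D₂₂ * (υ - D₁₂ * D₂₂⁻¹)ᵀ * ψ⁻¹ * (υ - D₁₂ * D₂₂⁻¹)).trace
  have he : Real.exp (-(a + b + d) / 2) =
      Real.exp (-a / 2) * Real.exp (-b / 2) * Real.exp (-d / 2) := by
    rw [← Real.exp_add, ← Real.exp_add]
    congr 1
    ring
  have hc' : c.det ^ (-(δ + 2 * (Fintype.card κ : ℝ)) / 2) = c.det ^ (Fintype.card ι : ℝ) *
      c.det ^ (-(δ + 2 * (Fintype.card (ι ⊕ κ) : ℝ)) / 2) := by
    rw [← Real.rpow_add hcd, Fintype.card_sum]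
    congr 1
    push_cast
    ring
  have hψ' : ψ.det ^ (-(δ + 2 * (Fintype.card (ι ⊕ κ) : ℝ)) / 2) =
      ψ.det ^ (-(δ + (Fintype.card κ : ℝ) + 2 * (Fintype.card ι : ℝ)) / 2) *
        ψ.det ^ (-((Fintype.card κ : ℝ) / 2)) := by
    rw [← Real.rpow_add hψd, Fintype.card_sum]
    congr 1
    push_cast
    ring
  rw [he, hc', hψ']
  ring

/-- The Schur complement, the regression matrix and the lower right block of a block matrix. -/
def schur (Z : Matrix (ι ⊕ κ) (ι ⊕ κ) ℝ) : (Matrix ι ι ℝ × Matrix ι κ ℝ) × Matrix κ κ ℝ :=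
  ((Z.toBlocks₁₁ - Z.toBlocks₁₂ * Z.toBlocks₂₂⁻¹ * Z.toBlocks₁₂ᵀ,
    Z.toBlocks₁₂ * Z.toBlocks₂₂⁻¹), Z.toBlocks₂₂)

omit [Fintype ι] [DecidableEq ι] in
theorem measurable_schur :
    Measurable (schur : Matrix (ι ⊕ κ) (ι ⊕ κ) ℝ → _) := by
  have h11 : Measurable fun Z : Matrix (ι ⊕ κ) (ι ⊕ κ) ℝ => Z.toBlocks₁₁ :=
    measurable_id.matrix_submatrix Sum.inl Sum.inl
  have h12 : Measurable fun Z : Matrix (ι ⊕ κ) (ι ⊕ κ) ℝ => Z.toBlocks₁₂ :=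
    measurable_id.matrix_submatrix Sum.inl Sum.inr
  have h22 : Measurable fun Z : Matrix (ι ⊕ κ) (ι ⊕ κ) ℝ => Z.toBlocks₂₂ :=
    measurable_id.matrix_submatrix Sum.inr Sum.inr
  have hr := h12.matrix_mul (measurable_matrix_inv.comp h22)
  exact ((h11.matrix_sub (hr.matrix_mul h12.matrix_transpose)).prodMk hr).prodMk h22

/-- The change of variables `b = υ c`, then `a = ψ + υ c υ'`, for fixed `c`. If `c` is not positive
definite, both integrands vanish. -/
theorem lintegral_schur (δ : ℝ) (D₁₁ : Matrix ι ι ℝ) (D₁₂ : Matrix ι κ ℝ)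
    {D₂₂ : Matrix κ κ ℝ} (hD : D₂₂.PosDef)
    {f : (Matrix ι ι ℝ × Matrix ι κ ℝ) × Matrix κ κ ℝ → ℝ≥0∞} (hf : Measurable f) :
    ∫⁻ Z, iwWeight δ (Matrix.fromBlocks D₁₁ D₁₂ D₁₂ᵀ D₂₂) Z * f (schur Z) ∂symVolume (ι ⊕ κ) =
      ∫⁻ c, iwWeight δ D₂₂ c * ∫⁻ ψ, iwWeight (δ + Fintype.card κ) (D₁₁ - D₁₂ * D₂₂⁻¹ * D₁₂ᵀ) ψ *
        ((ENNReal.ofReal (ψ.det ^ ((Fintype.card κ : ℝ) / 2)))⁻¹ *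
          ∫⁻ υ, normalWeight (D₁₂ * D₂₂⁻¹) ψ D₂₂⁻¹ υ * f ((ψ, υ), c)
            ∂matVolume ι κ) ∂symVolume ι ∂symVolume κ := by
  set D := Matrix.fromBlocks D₁₁ D₁₂ D₁₂ᵀ D₂₂
  have hg : Measurable fun Z => iwWeight δ D Z * f (schur Z) :=
    (measurable_iwWeight δ D).mul (hf.comp measurable_schur)
  rw [lintegral_symVolume_sum hg]
  refine lintegral_congr fun c => ?_
  by_cases hc : c.PosDef
  swap
  · rw [iwWeight_of_not_posDef _ _ hc, zero_mul]
    have h0 : ∀ (b : Matrix ι κ ℝ) (a : Matrix ι ι ℝ),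
        iwWeight δ D (Matrix.fromBlocks a b bᵀ c) = 0 := fun b a =>
      iwWeight_of_not_posDef _ _ fun h => hc (posDef_fromBlocks_iff.1 h).1
    simp [h0]
  have hct := transpose_eq_of_posDef hc
  have hblk : Measurable fun q : Matrix ι κ ℝ × Matrix ι ι ℝ =>
      Matrix.fromBlocks q.2 q.1 q.1ᵀ c := by
    refine measurable_matrix_iff.2 ?_
    rintro (i | i) (j | j)
    · exact (measurable_matrix_entry i j).comp measurable_snd
    · exact (measurable_matrix_entry i j).comp measurable_fst
    · exact (measurable_matrix_entry j i).comp measurable_fst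
    · exact measurable_const
  have hgb := hg.comp hblk
  have hinner : Measurable fun b => ∫⁻ a, (fun Z => iwWeight δ D Z * f (schur Z))
      (Matrix.fromBlocks a b bᵀ c) ∂symVolume ι := Measurable.lintegral_prod_right' hgb
  rw [lintegral_matVolume_mul_right hc.det_pos.ne' hinner]
  have hshift : ∀ υ : Matrix ι κ ℝ, ∫⁻ a, (fun Z => iwWeight δ D Z * f (schur Z))
      (Matrix.fromBlocks a (υ * c) (υ * c)ᵀ c) ∂symVolume ι =
      ∫⁻ ψ, (fun Z => iwWeight δ D Z * f (schur Z))
        (Matrix.fromBlocks (ψ + υ * c * υᵀ) (υ * c) (υ * c)ᵀ c) ∂symVolume ι := fun υ => by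
    have hm : Measurable fun a => (fun Z => iwWeight δ D Z * f (schur Z))
        (Matrix.fromBlocks a (υ * c) (υ * c)ᵀ c) := hgb.comp measurable_prodMk_left
    refine (lintegral_symVolume_add hm (s := υ * c * υᵀ) ?_).symm
    rw [Matrix.transpose_mul, Matrix.transpose_mul, Matrix.transpose_transpose, hct,
      Matrix.mul_assoc]
  simp only [hshift]
  have hnw := measurable_normalWeight (D₁₂ * D₂₂⁻¹) D₂₂⁻¹
  have hfc : Measurable fun p : Matrix ι ι ℝ × Matrix ι κ ℝ => f (p, c) :=
    hf.comp measurable_prodMk_right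
  have hiw := measurable_iwWeight (δ + Fintype.card κ) (D₁₁ - D₁₂ * D₂₂⁻¹ * D₁₂ᵀ)
  have hdet : Measurable fun ψ : Matrix ι ι ℝ =>
      (ENNReal.ofReal (ψ.det ^ ((Fintype.card κ : ℝ) / 2)))⁻¹ :=
    (measurable_matrix_det.pow_const _).ennreal_ofReal.inv
  have hpt : ∀ (υ : Matrix ι κ ℝ) (ψ : Matrix ι ι ℝ), ENNReal.ofReal |c.det| ^ Fintype.card ι *
      (iwWeight δ D (Matrix.fromBlocks (ψ + υ * c * υᵀ) (υ * c) (υ * c)ᵀ c) *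
        f (schur (Matrix.fromBlocks (ψ + υ * c * υᵀ) (υ * c) (υ * c)ᵀ c))) =
      iwWeight δ D₂₂ c * (iwWeight (δ + Fintype.card κ) (D₁₁ - D₁₂ * D₂₂⁻¹ * D₁₂ᵀ) ψ *
        ((ENNReal.ofReal (ψ.det ^ ((Fintype.card κ : ℝ) / 2)))⁻¹ *
          (normalWeight (D₁₂ * D₂₂⁻¹) ψ D₂₂⁻¹ υ * f ((ψ, υ), c)))) := fun υ ψ => by
    by_cases hψ : ψ.PosDef
    · have hs : schur (Matrix.fromBlocks (ψ + υ * c * υᵀ) (υ * c) (υ * c)ᵀ c) = ((ψ, υ), c) := by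
        simp only [schur, Matrix.toBlocks_fromBlocks₁₁, Matrix.toBlocks_fromBlocks₁₂,
          Matrix.toBlocks_fromBlocks₂₂]
        rw [schur_compl_regression hc,
          Matrix.mul_nonsing_inv_cancel_right _ _ hc.det_pos.ne'.isUnit]
      rw [hs, ← mul_assoc, iwWeight_regression δ D₁₁ D₁₂ hD hc hψ]
      simp only [mul_assoc]
    · rw [iwWeight_of_not_posDef _ _ hψ,
        iwWeight_of_not_posDef _ _ fun h => hψ ((posDef_regression_iff hc).1 h)]
      simp
  have hm2 : Measurable (Function.uncurry fun (ψ : Matrix ι ι ℝ) (υ : Matrix ι κ ℝ) =>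
      iwWeight (δ + Fintype.card κ) (D₁₁ - D₁₂ * D₂₂⁻¹ * D₁₂ᵀ) ψ *
        ((ENNReal.ofReal (ψ.det ^ ((Fintype.card κ : ℝ) / 2)))⁻¹ *
          (normalWeight (D₁₂ * D₂₂⁻¹) ψ D₂₂⁻¹ υ * f ((ψ, υ), c)))) :=
    (hiw.comp measurable_fst).mul ((hdet.comp measurable_fst).mul (hnw.mul hfc))
  have hk : ENNReal.ofReal |c.det| ^ Fintype.card ι ≠ ∞ := by simp
  have hk2 : iwWeight δ D₂₂ c ≠ ∞ := by
    rw [iwWeight_of_posDef _ _ hc]; exact ENNReal.ofReal_ne_top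
  rw [← lintegral_const_mul' _ _ hk]
  simp only [← lintegral_const_mul' _ _ hk, hpt]
  simp only [lintegral_const_mul' _ _ hk2]
  congr 1
  -- The integral over `υ` becomes the inner one, so that it can be read as a conditional law given
  -- `ψ`.
  refine Eq.trans (lintegral_lintegral_swap (μ := symVolume ι) (ν := matVolume ι κ)
    hm2.aemeasurable).symm ?_
  refine lintegral_congr fun ψ => ?_
  have hmψ : Measurable fun υ => normalWeight (D₁₂ * D₂₂⁻¹) ψ D₂₂⁻¹ υ * f ((ψ, υ), c) :=
    (measurable_normalWeight_right _ _ _).mul (hfc.comp measurable_prodMk_left)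
  rw [lintegral_const_mul _ (hmψ.const_mul _), lintegral_const_mul _ hmψ]

/-- Normalizing the Gaussian factor for each `ψ` uses up the power of `|ψ|` and leaves the constant
`normalMass`, which does not depend on `ψ` or `c`; hence the product form. -/
theorem map_schur_withDensity (δ : ℝ) (D₁₁ : Matrix ι ι ℝ) (D₁₂ : Matrix ι κ ℝ)
    {D₂₂ : Matrix κ κ ℝ} (hD : D₂₂.PosDef) (h0 : normalMass ι D₂₂⁻¹ ≠ 0)
    (h1 : normalMass ι D₂₂⁻¹ ≠ ∞) :
    ((symVolume (ι ⊕ κ)).withDensity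
      (iwWeight δ (Matrix.fromBlocks D₁₁ D₁₂ D₁₂ᵀ D₂₂))).map schur =
      normalMass ι D₂₂⁻¹ • (((symVolume ι).withDensity
        (iwWeight (δ + Fintype.card κ) (D₁₁ - D₁₂ * D₂₂⁻¹ * D₁₂ᵀ))) ⊗ₘ
          normalKernel (D₁₂ * D₂₂⁻¹) D₂₂⁻¹).prod
        ((symVolume κ).withDensity (iwWeight δ D₂₂)) := by
  have := isMarkovKernel_normalKernel (ι := ι) (D₁₂ * D₂₂⁻¹) h0 h1
  refine Measure.ext_of_lintegral _ fun f hf => ?_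
  have hfc : ∀ c, Measurable fun p : Matrix ι ι ℝ × Matrix ι κ ℝ => f (p, c) := fun c =>
    hf.comp measurable_prodMk_right
  have hfs : Measurable fun Z : Matrix (ι ⊕ κ) (ι ⊕ κ) ℝ => f (schur Z) := hf.comp measurable_schur
  have hint : ∀ c, Measurable fun ψ => ∫⁻ υ, f ((ψ, υ), c)
      ∂normalKernel (D₁₂ * D₂₂⁻¹) D₂₂⁻¹ ψ := fun c => (hfc c).lintegral_kernel_prod_right'
  have hall : Measurable fun c => ∫⁻ p, f (p, c) ∂(((symVolume ι).withDensity
        (iwWeight (δ + Fintype.card κ) (D₁₁ - D₁₂ * D₂₂⁻¹ * D₁₂ᵀ))) ⊗ₘ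
          normalKernel (D₁₂ * D₂₂⁻¹) D₂₂⁻¹) := hf.lintegral_prod_left'
  rw [lintegral_map hf measurable_schur,
    lintegral_withDensity_eq_lintegral_mul _ (measurable_iwWeight _ _) hfs]
  simp only [Pi.mul_apply]
  rw [lintegral_schur δ D₁₁ D₁₂ hD hf, lintegral_smul_measure, smul_eq_mul,
    lintegral_prod_symm' _ hf,
    lintegral_withDensity_eq_lintegral_mul _ (measurable_iwWeight _ _) hall,
    ← lintegral_const_mul' _ _ h1]
  refine lintegral_congr fun c => ?_
  rw [Pi.mul_apply, mul_left_comm, Measure.lintegral_compProd (hfc c),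
    lintegral_withDensity_eq_lintegral_mul _ (measurable_iwWeight _ _) (hint c),
    ← lintegral_const_mul' _ _ h1]
  congr 1
  refine lintegral_congr fun ψ => ?_
  rw [Pi.mul_apply, mul_left_comm (normalMass ι D₂₂⁻¹)]
  by_cases hψ : ψ.PosDef
  swap
  · simp [iwWeight_of_not_posDef _ _ hψ]
  congr 1
  have hmψ : Measurable (normalWeight (D₁₂ * D₂₂⁻¹) ψ D₂₂⁻¹) := measurable_normalWeight_right _ _ _
  have hfψ : Measurable fun υ => f ((ψ, υ), c) := (hfc c).comp measurable_prodMk_left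
  have hpos : ENNReal.ofReal (ψ.det ^ ((Fintype.card κ : ℝ) / 2)) ≠ 0 := by
    simpa using Real.rpow_pos_of_pos hψ.det_pos _
  rw [normalKernel_apply _ _ hψ, matrixNormal_eq, normalized, withDensity_apply _ .univ,
    Measure.restrict_univ, lintegral_normalWeight _ hψ, lintegral_smul_measure, smul_eq_mul,
    lintegral_withDensity_eq_lintegral_mul _ hmψ hfψ,
    ENNReal.mul_inv (.inl hpos) (.inl ENNReal.ofReal_ne_top), ← mul_assoc, mul_comm (normalMass _ _),
    mul_assoc (_ : ℝ≥0∞)⁻¹ _ (normalMass _ _), ENNReal.inv_mul_cancel h0 h1, mul_one]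
  rfl

/-- The test function `1` in `lintegral_schur` writes the total mass as a product of three masses. A
product that is neither `0` nor `∞` has no factor `0` or `∞`. -/
theorem masses_of_isProbabilityMeasure_invWishart (δ : ℝ) (D₁₁ : Matrix ι ι ℝ)
    (D₁₂ : Matrix ι κ ℝ) {D₂₂ : Matrix κ κ ℝ} (hD : D₂₂.PosDef)
    (h : IsProbabilityMeasure (invWishart δ (Matrix.fromBlocks D₁₁ D₁₂ D₁₂ᵀ D₂₂))) :
    (normalMass ι D₂₂⁻¹ ≠ 0 ∧ normalMass ι D₂₂⁻¹ ≠ ∞) ∧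
    IsProbabilityMeasure (invWishart δ D₂₂) ∧
    IsProbabilityMeasure
      (invWishart (δ + Fintype.card κ) (D₁₁ - D₁₂ * D₂₂⁻¹ * D₁₂ᵀ)) := by
  rw [invWishart_eq] at h
  obtain ⟨h0, h1⟩ := mass_of_isProbabilityMeasure_normalized h
  have hprod := lintegral_schur δ D₁₁ D₁₂ hD (f := fun _ => 1) measurable_const
  have hmass : ((symVolume (ι ⊕ κ)).withDensity
      (iwWeight δ (Matrix.fromBlocks D₁₁ D₁₂ D₁₂ᵀ D₂₂))) Set.univ =
      (∫⁻ c, iwWeight δ D₂₂ c ∂symVolume κ) *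
        ((∫⁻ ψ, iwWeight (δ + Fintype.card κ) (D₁₁ - D₁₂ * D₂₂⁻¹ * D₁₂ᵀ) ψ ∂symVolume ι) *
          normalMass ι D₂₂⁻¹) := by
    rw [withDensity_apply _ .univ, Measure.restrict_univ]
    simp only [mul_one] at hprod
    rw [hprod, lintegral_mul_const _ (measurable_iwWeight _ _)]
    congr 1
    rw [← lintegral_mul_const _ (measurable_iwWeight _ _)]
    refine lintegral_congr fun ψ => ?_
    by_cases hψ : ψ.PosDef
    · have hpos : ENNReal.ofReal (ψ.det ^ ((Fintype.card κ : ℝ) / 2)) ≠ 0 := by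
        simpa using Real.rpow_pos_of_pos hψ.det_pos _
      rw [lintegral_normalWeight _ hψ, ← mul_assoc (_ : ℝ≥0∞)⁻¹,
        ENNReal.inv_mul_cancel hpos ENNReal.ofReal_ne_top, one_mul]
    · simp [iwWeight_of_not_posDef _ _ hψ]
  rw [hmass] at h0 h1
  have hc0 := left_ne_zero_of_mul h0
  have hψ0 := left_ne_zero_of_mul (right_ne_zero_of_mul h0)
  have hn0 := right_ne_zero_of_mul (right_ne_zero_of_mul h0)
  have hc1 := (ENNReal.lt_top_of_mul_ne_top_left h1 (right_ne_zero_of_mul h0)).ne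
  have hr1 := (ENNReal.lt_top_of_mul_ne_top_right h1 hc0).ne
  have hψ1 := (ENNReal.lt_top_of_mul_ne_top_left hr1 hn0).ne
  have hn1 := (ENNReal.lt_top_of_mul_ne_top_right hr1 hψ0).ne
  refine ⟨⟨hn0, hn1⟩, ?_, ?_⟩ <;> rw [invWishart_eq] <;> apply isProbabilityMeasure_normalized <;>
    rw [withDensity_apply _ .univ, Measure.restrict_univ] <;> assumption

/-- The blockwise factorization of the inverse Wishart law: the Schur complement `Ψ` is inverse
Wishart, the regression matrix is matrix normal given `Ψ`, and both are independent of the lower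
right block, which is inverse Wishart. -/
theorem map_schur_invWishart (δ : ℝ) (D₁₁ : Matrix ι ι ℝ)
    (D₁₂ : Matrix ι κ ℝ) {D₂₂ : Matrix κ κ ℝ} (hD : D₂₂.PosDef)
    (h : IsProbabilityMeasure (invWishart δ (Matrix.fromBlocks D₁₁ D₁₂ D₁₂ᵀ D₂₂))) :
    (invWishart δ (Matrix.fromBlocks D₁₁ D₁₂ D₁₂ᵀ D₂₂)).map schur =
      ((invWishart (δ + Fintype.card κ) (D₁₁ - D₁₂ * D₂₂⁻¹ * D₁₂ᵀ)) ⊗ₘ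
        normalKernel (D₁₂ * D₂₂⁻¹) D₂₂⁻¹).prod (invWishart δ D₂₂) := by
  obtain ⟨⟨hn0, hn1⟩, hp2, hp1⟩ := masses_of_isProbabilityMeasure_invWishart δ D₁₁ D₁₂ hD h
  have := isMarkovKernel_normalKernel (ι := ι) (D₁₂ * D₂₂⁻¹) hn0 hn1
  have key := map_schur_withDensity δ D₁₁ D₁₂ hD hn0 hn1
  rw [invWishart_eq] at h hp1 hp2
  have hm := mass_of_isProbabilityMeasure_normalized h
  have hm1 := mass_of_isProbabilityMeasure_normalized hp1
  have hm2 := mass_of_isProbabilityMeasure_normalized hp2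
  rw [← smul_normalized hm.1 hm.2, ← smul_normalized hm1.1 hm1.2,
    ← smul_normalized hm2.1 hm2.2, Measure.map_smul] at key
  rw [invWishart_eq, invWishart_eq, invWishart_eq]
  rw [Measure.compProd_smul_left, Measure.prod_smul_left, Measure.prod_smul_right, smul_smul,
    smul_smul] at key
  have hpL : IsProbabilityMeasure ((normalized ((symVolume (ι ⊕ κ)).withDensity
      (iwWeight δ (Matrix.fromBlocks D₁₁ D₁₂ D₁₂ᵀ D₂₂)))).map schur) :=
    Measure.isProbabilityMeasure_map measurable_schur.aemeasurable
  -- Both sides are now multiples of probability measures, so comparing total masses identifies the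
  -- two constants.
  have htot := congrArg (fun ν => ν Set.univ) key
  simp only [Measure.smul_apply, measure_univ, smul_eq_mul, mul_one] at htot
  rw [← htot] at key
  have := congrArg (fun ν => (((symVolume (ι ⊕ κ)).withDensity
      (iwWeight δ (Matrix.fromBlocks D₁₁ D₁₂ D₁₂ᵀ D₂₂))) Set.univ)⁻¹ • ν) key
  simpa only [smul_smul, ENNReal.inv_mul_cancel hm.1 hm.2, one_smul] using this

end InverseWishart

/-! ### Invariance under relabelling of indices -/

section Reindex

variable {ι ι' : Type*} [Fintype ι] [DecidableEq ι] [Fintype ι'] [DecidableEq ι']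

omit [DecidableEq ι] [DecidableEq ι'] in
theorem map_submatrix_symVolume (e : ι' ≃ ι) :
    (symVolume ι).map (fun A => A.submatrix e e) = symVolume ι' := by
  let g : (Sym2 ι → ℝ) → (Sym2 ι' → ℝ) := fun x z => x (Sym2.map e z)
  have hg : Measurable g := measurable_pi_lambda _ fun z => measurable_pi_apply _
  have hvol : Measure.map g volume = volume := by
    refine (Measure.pi_eq fun s hs => ?_).symm
    have hb : ∀ z, Sym2.map e (Sym2.map e.symm z) = z := fun z => by simp [Sym2.map_map]
    have hb' : ∀ z, Sym2.map e.symm (Sym2.map e z) = z := fun z => by simp [Sym2.map_map]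
    let E : Sym2 ι' ≃ Sym2 ι := ⟨Sym2.map e, Sym2.map e.symm, hb', hb⟩
    have : g ⁻¹' Set.univ.pi s = Set.univ.pi fun z => s (E.symm z) := by
      ext x
      simp only [Set.mem_preimage, Set.mem_pi, Set.mem_univ, true_imp_iff]
      rw [← E.forall_congr_right (q := fun z => x z ∈ s (E.symm z))]
      simp [g, E, hb']
    rw [Measure.map_apply hg (.univ_pi hs), this, volume_pi_pi,
      ← E.prod_comp fun z => volume (s (E.symm z))]
    simp
  have hsub : Measurable fun A : Matrix ι ι ℝ => A.submatrix e e :=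
    measurable_id.matrix_submatrix e e
  rw [symVolume, Measure.map_map hsub measurable_symMatrix, symVolume, ← hvol,
    Measure.map_map measurable_symMatrix hg]
  rfl

theorem iwWeight_submatrix (δ : ℝ) (D A : Matrix ι ι ℝ) (e : ι' ≃ ι) :
    iwWeight δ (D.submatrix e e) (A.submatrix e e) = iwWeight δ D A := by
  have hiff : (A.submatrix e e).PosDef ↔ A.PosDef :=
    ⟨fun h => by simpa using h.submatrix e.symm.injective, fun h => h.submatrix e.injective⟩
  by_cases hA : A.PosDef
  · rw [iwWeight_of_posDef _ _ hA, iwWeight_of_posDef _ _ (hiff.2 hA), Matrix.det_submatrix_equiv_self,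
      Matrix.inv_submatrix_equiv, Matrix.submatrix_mul_equiv, Fintype.card_congr e]
    congr 5
    exact e.sum_comp fun i => (D * A⁻¹) i i
  · rw [iwWeight_of_not_posDef _ _ hA, iwWeight_of_not_posDef _ _ (mt hiff.1 hA)]

/-- Relabelling permutes the coordinates of Lebesgue measure and preserves determinant and trace. It
is needed for the swap of the two diagonal blocks, which is time reversal of one step. -/
theorem map_submatrix_invWishart (δ : ℝ) (D : Matrix ι ι ℝ) (e : ι' ≃ ι) :
    (invWishart δ D).map (fun A => A.submatrix e e) = invWishart δ (D.submatrix e e) := by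
  have hsub : Measurable fun A : Matrix ι ι ℝ => A.submatrix e e :=
    measurable_id.matrix_submatrix e e
  have h : ((symVolume ι).withDensity (iwWeight δ D)).map (fun A => A.submatrix e e) =
      (symVolume ι').withDensity (iwWeight δ (D.submatrix e e)) := by
    rw [← map_submatrix_symVolume e, ← map_withDensity_comp _ hsub (measurable_iwWeight _ _)]
    simp only [iwWeight_submatrix]
  rw [invWishart_eq, invWishart_eq, normalized, normalized, Measure.map_smul, h, ← h,
    Measure.map_apply hsub .univ, Set.preimage_univ, h]

end Reindex

/-! ### Stationary Markov chains with links -/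

section Markov

variable {Ω α β γ : Type*} [MeasurableSpace Ω] [MeasurableSpace α] [MeasurableSpace β]
  [MeasurableSpace γ]

/-- The path of the process `X` with links `Y` from time `t` to time `t + s`. -/
def path (X : ℕ → Ω → α) (Y : ℕ → Ω → β) (t s : ℕ) (ω : Ω) : (Fin (s + 1) → α) × (Fin s → β) :=
  (fun i => X (t + i) ω, fun i => Y (t + i) ω)

/-- Extension of a path by one step. -/
def extend {s : ℕ} (p : (Fin (s + 1) → α) × (Fin s → β)) (z : β × α) :
    (Fin (s + 2) → α) × (Fin (s + 1) → β) :=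
  (Fin.snoc p.1 z.2, Fin.snoc p.2 z.1)

/-- The reversal of a path, with its links transformed by `σ`. -/
def reversePath (σ : β → β) {s : ℕ} (p : (Fin (s + 1) → α) × (Fin s → β)) :
    (Fin (s + 1) → α) × (Fin s → β) :=
  (fun i => p.1 i.rev, fun i => σ (p.2 i.rev))

theorem measurable_path {X : ℕ → Ω → α} {Y : ℕ → Ω → β} (hX : ∀ t, Measurable (X t))
    (hY : ∀ t, Measurable (Y t)) (t s : ℕ) : Measurable (path X Y t s) :=
  (measurable_pi_lambda _ fun _ => hX _).prodMk (measurable_pi_lambda _ fun _ => hY _)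

theorem measurable_extend {s : ℕ} : Measurable fun q : ((Fin (s + 1) → α) × (Fin s → β)) × (β × α) =>
    extend q.1 q.2 := by
  refine (measurable_pi_lambda _ fun i => ?_).prodMk (measurable_pi_lambda _ fun i => ?_)
  · refine Fin.lastCases ?_ (fun j => ?_) i <;>
      simp only [Fin.snoc_last, Fin.snoc_castSucc] <;> fun_prop
  · refine Fin.lastCases ?_ (fun j => ?_) i <;>
      simp only [Fin.snoc_last, Fin.snoc_castSucc] <;> fun_prop

theorem measurable_reversePath {σ : β → β} (hσ : Measurable σ) {s : ℕ} :
    Measurable (reversePath σ : (Fin (s + 1) → α) × (Fin s → β) → _) :=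
  (measurable_pi_lambda _ fun _ => (measurable_pi_apply _).comp measurable_fst).prodMk
    (measurable_pi_lambda _ fun _ => hσ.comp ((measurable_pi_apply _).comp measurable_snd))

omit [MeasurableSpace Ω] [MeasurableSpace α] [MeasurableSpace β] in
theorem path_succ (X : ℕ → Ω → α) (Y : ℕ → Ω → β) (t s : ℕ) (ω : Ω) :
    path X Y t (s + 1) ω = extend (path X Y t s ω) (Y (t + s) ω, X (t + s + 1) ω) := by
  refine Prod.ext (funext fun i => ?_) (funext fun i => ?_)
  · refine Fin.lastCases ?_ (fun j => ?_) i <;> simp [path, extend, add_assoc]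
  · refine Fin.lastCases ?_ (fun j => ?_) i <;> simp [path, extend]

-- A reversed path grows at its end when the original path grows at its start; this lets the
-- induction for reversibility append the earliest link and state.
omit [MeasurableSpace Ω] [MeasurableSpace α] [MeasurableSpace β] in
theorem reversePath_path_succ (σ : β → β) (X : ℕ → Ω → α) (Y : ℕ → Ω → β) (t s : ℕ) (ω : Ω) :
    reversePath σ (path X Y t (s + 1) ω) =
      extend (reversePath σ (path X Y (t + 1) s ω)) (σ (Y t ω), X t ω) := by
  refine Prod.ext (funext fun i => ?_) (funext fun i => ?_)
  · refine Fin.lastCases ?_ (fun j => ?_) i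
    · simp [path, extend, reversePath]
    · simp only [path, extend, reversePath, Fin.snoc_castSucc, Fin.rev_castSucc, Fin.val_succ]
      congr 1
      omega
  · refine Fin.lastCases ?_ (fun j => ?_) i
    · simp [path, extend, reversePath]
    · simp only [path, extend, reversePath, Fin.snoc_castSucc, Fin.rev_castSucc, Fin.val_succ]
      congr 2
      omega

/-- A Markov chain `X` with links `Y` and transition kernel `K`: given the path up to time `t`, the
next link and state have law `K (X t)`, and the consecutive pairs are identically distributed. -/
structure IsStationaryChain (μ : Measure Ω) (X : ℕ → Ω → α) (Y : ℕ → Ω → β)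
    (K : Kernel α (β × α)) : Prop where
  measurable_state : ∀ t, Measurable (X t)
  measurable_link : ∀ t, Measurable (Y t)
  map_state : ∀ t, μ.map (X t) = μ.map (X 0)
  map_path_next : ∀ t, μ.map (fun ω => (path X Y 0 t ω, (Y t ω, X (t + 1) ω))) =
    μ.map (path X Y 0 t) ⊗ₘ K.comap (fun p => p.1 (Fin.last t)) (by fun_prop)

variable {μ : Measure Ω} [IsProbabilityMeasure μ] {X : ℕ → Ω → α} {Y : ℕ → Ω → β}
  {K : Kernel α (β × α)} [IsMarkovKernel K]

namespace IsStationaryChain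

theorem lintegral_next (h : IsStationaryChain μ X Y K) (t : ℕ)
    {W : (Fin (t + 1) → α) × (Fin t → β) → γ} (hW : Measurable W) {f : γ × (β × α) → ℝ≥0∞}
    (hf : Measurable f) :
    ∫⁻ ω, f (W (path X Y 0 t ω), (Y t ω, X (t + 1) ω)) ∂μ =
      ∫⁻ ω, ∫⁻ z, f (W (path X Y 0 t ω), z) ∂K (X t ω) ∂μ := by
  have hp := measurable_path h.measurable_state h.measurable_link 0 t
  have hm : Measurable fun ω => (path X Y 0 t ω, (Y t ω, X (t + 1) ω)) :=
    hp.prodMk ((h.measurable_link t).prodMk (h.measurable_state (t + 1)))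
  have hfW : Measurable fun q : ((Fin (t + 1) → α) × (Fin t → β)) × (β × α) => f (W q.1, q.2) :=
    hf.comp ((hW.comp measurable_fst).prodMk measurable_snd)
  have h1 := lintegral_map (μ := μ) hfW hm
  rw [h.map_path_next, Measure.lintegral_compProd hfW, lintegral_map
    (Measurable.lintegral_kernel_prod_right' hfW) hp] at h1
  rw [← h1]
  simp [Kernel.comap_apply, path]

/-- A path from time `t` on as a function of the path from time `0` on. -/
def restrictPath (t s : ℕ) (p : (Fin (t + s + 1) → α) × (Fin (t + s) → β)) :
    (Fin (s + 1) → α) × (Fin s → β) :=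
  (fun i => p.1 (Fin.cast (add_assoc t s 1).symm (Fin.natAdd t i)), fun i => p.2 (Fin.natAdd t i))

theorem measurable_restrictPath (t s : ℕ) :
    Measurable (restrictPath (α := α) (β := β) t s) := by
  unfold restrictPath; fun_prop

omit [MeasurableSpace Ω] [MeasurableSpace α] [MeasurableSpace β] in
theorem restrictPath_path (t s : ℕ) (ω : Ω) :
    restrictPath t s (path X Y 0 (t + s) ω) = path X Y t s ω := by
  simp [restrictPath, path]

/-- The initial segment of a path. -/
def truncatePath (t s : ℕ) (p : (Fin (t + s + 1) → α) × (Fin (t + s) → β)) :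
    (Fin (t + 1) → α) × (Fin t → β) :=
  (fun i => p.1 (Fin.castLE (by omega) i), fun i => p.2 (Fin.castLE (by omega) i))

theorem measurable_truncatePath (t s : ℕ) :
    Measurable (truncatePath (α := α) (β := β) t s) := by
  unfold truncatePath; fun_prop

omit [MeasurableSpace Ω] [MeasurableSpace α] [MeasurableSpace β] in
theorem truncatePath_path (t s : ℕ) (ω : Ω) :
    truncatePath t s (path X Y 0 (t + s) ω) = path X Y 0 t ω := by
  simp [truncatePath, path]

/-- The Markov property: the conditional law of a function of the past given the present is its
conditional law given the present and the future. -/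
theorem lintegral_path (h : IsStationaryChain μ X Y K) (t : ℕ)
    {W : (Fin (t + 1) → α) × (Fin t → β) → γ} (hW : Measurable W) {κ : Kernel α γ}
    [IsMarkovKernel κ]
    (hκ : μ.map (fun ω => (X t ω, W (path X Y 0 t ω))) = μ.map (X t) ⊗ₘ κ) (s : ℕ)
    {f : ((Fin (s + 1) → α) × (Fin s → β)) × γ → ℝ≥0∞} (hf : Measurable f) :
    ∫⁻ ω, f (path X Y t s ω, W (path X Y 0 t ω)) ∂μ =
      ∫⁻ ω, ∫⁻ w, f (path X Y t s ω, w) ∂κ (X t ω) ∂μ := by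
  have hp := measurable_path h.measurable_state h.measurable_link
  induction s with
  | zero =>
    let g : α → (Fin (0 + 1) → α) × (Fin 0 → β) := fun x => (fun _ => x, Fin.elim0)
    have hg : Measurable g :=
      (measurable_pi_lambda _ fun _ => measurable_id).prodMk measurable_const
    have hgp : ∀ ω, path X Y t 0 ω = g (X t ω) := fun ω => by
      refine Prod.ext (funext fun i => ?_) (funext fun i => i.elim0)
      fin_cases i
      simp [path, g]
    have hfg : Measurable fun q : α × γ => f (g q.1, q.2) :=
      hf.comp ((hg.comp measurable_fst).prodMk measurable_snd)
    have h1 := lintegral_map (μ := μ) hfg ((h.measurable_state t).prodMk (hW.comp (hp 0 t)))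
    simp only [Function.comp_def] at h1
    rw [hκ, Measure.lintegral_compProd hfg, lintegral_map
      (Measurable.lintegral_kernel_prod_right' hfg) (h.measurable_state t)] at h1
    simp only [hgp]
    exact h1.symm
  | succ s ih =>
    have he : Measurable fun q : (((Fin (s + 1) → α) × (Fin s → β)) × γ) × (β × α) =>
        f (extend q.1.1 q.2, q.1.2) :=
      hf.comp ((measurable_extend.comp (measurable_fst.fst.prodMk measurable_snd)).prodMk
        measurable_fst.snd)
    have hWt : Measurable fun p => (restrictPath (α := α) (β := β) t s p, W (truncatePath t s p)) :=
      (measurable_restrictPath t s).prodMk (hW.comp (measurable_truncatePath t s))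
    have h1 := h.lintegral_next (t + s) hWt he
    simp only [restrictPath_path, truncatePath_path, ← path_succ] at h1
    have hlast : ∀ ω, X (t + s) ω = (path X Y t s ω).1 (Fin.last s) := fun ω => by simp [path]
    have hfirst : ∀ ω, X t ω = (path X Y t s ω).1 0 := fun ω => by simp [path]
    let K' : Kernel (((Fin (s + 1) → α) × (Fin s → β)) × γ) (β × α) :=
      K.comap (fun p => p.1.1 (Fin.last s)) (by fun_prop)
    have hK' : Measurable fun p : ((Fin (s + 1) → α) × (Fin s → β)) × γ =>
        ∫⁻ z, f (extend p.1 z, p.2) ∂K (p.1.1 (Fin.last s)) :=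
      Measurable.lintegral_kernel_prod_right' (κ := K') he
    -- The last step of the future is integrated out with `K`, which leaves a function of a shorter
    -- path and `W` for the induction hypothesis.
    rw [h1]
    simp only [hlast]
    rw [ih hK']
    let κ' : Kernel (((Fin (s + 1) → α) × (Fin s → β)) × (β × α)) γ :=
      κ.comap (fun p => p.1.1 0) (by fun_prop)
    have he2 : Measurable fun q : (((Fin (s + 1) → α) × (Fin s → β)) × (β × α)) × γ =>
        f (extend q.1.1 q.1.2, q.2) :=
      hf.comp ((measurable_extend.comp measurable_fst).prodMk measurable_snd)
    have hκ' : Measurable fun q : ((Fin (s + 1) → α) × (Fin s → β)) × (β × α) =>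
        ∫⁻ w, f (extend q.1 q.2, w) ∂κ (q.1.1 0) :=
      Measurable.lintegral_kernel_prod_right' (κ := κ') he2
    -- The same step is put back after `W` has been integrated out. `κ` sees only the first state of
    -- the path and `K` only the last, so the two integrals commute.
    have h2 := h.lintegral_next (t + s) (measurable_restrictPath t s) hκ'
    simp only [restrictPath_path, ← path_succ, ← hfirst] at h2
    rw [h2]
    refine lintegral_congr fun ω => ?_
    simp only [← hlast]
    refine lintegral_lintegral_swap (Measurable.aemeasurable ?_)
    exact hf.comp ((measurable_extend.comp (measurable_const.prodMk measurable_snd)).prodMk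
        measurable_fst)

theorem map_path_succ (h : IsStationaryChain μ X Y K) (t s : ℕ) :
    μ.map (path X Y t (s + 1)) =
      (μ.map (path X Y t s) ⊗ₘ K.comap (fun p => p.1 (Fin.last s)) (by fun_prop)).map
        fun q => extend q.1 q.2 := by
  have hp := measurable_path h.measurable_state h.measurable_link
  refine Measure.ext_of_lintegral _ fun f hf => ?_
  have he : Measurable fun q : ((Fin (s + 1) → α) × (Fin s → β)) × (β × α) =>
      f (extend q.1 q.2) := hf.comp measurable_extend
  have h1 := h.lintegral_next (t + s) (measurable_restrictPath t s) he
  simp only [restrictPath_path, ← path_succ] at h1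
  rw [lintegral_map hf (hp t (s + 1)), h1, lintegral_map hf measurable_extend,
    Measure.lintegral_compProd he, lintegral_map (Measurable.lintegral_kernel_prod_right' he)
    (hp t s)]
  simp [Kernel.comap_apply, path]

theorem map_path (h : IsStationaryChain μ X Y K) (t s : ℕ) :
    μ.map (path X Y t s) = μ.map (path X Y 0 s) := by
  induction s with
  | zero =>
    let g : α → (Fin (0 + 1) → α) × (Fin 0 → β) := fun x => (fun _ => x, Fin.elim0)
    have hg : Measurable g :=
      (measurable_pi_lambda _ fun _ => measurable_id).prodMk measurable_const
    have hgp : ∀ t, path X Y t 0 = g ∘ X t := fun t => funext fun ω => by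
      refine Prod.ext (funext fun i => ?_) (funext fun i => i.elim0)
      fin_cases i
      simp [path, g]
    rw [hgp, hgp, ← Measure.map_map hg (h.measurable_state t), h.map_state,
      ← Measure.map_map hg (h.measurable_state 0)]
  | succ s ih => rw [h.map_path_succ, ih, ← h.map_path_succ]

/-- A chain whose one-step law is symmetric is time-reversible. -/
theorem map_reversePath (h : IsStationaryChain μ X Y K) {σ : β → β} (hσ : Measurable σ)
    (hsymm : μ.map (fun ω => (X 1 ω, (σ (Y 0 ω), X 0 ω))) =
      μ.map (fun ω => (X 0 ω, (Y 0 ω, X 1 ω)))) (T : ℕ) :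
    μ.map (fun ω => reversePath σ (path X Y 0 T ω)) = μ.map (path X Y 0 T) := by
  have hp := measurable_path h.measurable_state h.measurable_link
  have hr : ∀ s, Measurable (reversePath (α := α) σ (s := s)) := fun s => measurable_reversePath hσ
  induction T with
  | zero =>
    congr 1
    funext ω
    refine Prod.ext (funext fun i => ?_) (funext fun i => i.elim0)
    fin_cases i
    simp [path, reversePath]
  | succ T ih =>
    have hW : Measurable fun p : (Fin (1 + 1) → α) × (Fin 1 → β) => (σ (p.2 0), p.1 0) :=
      (hσ.comp ((measurable_pi_apply _).comp measurable_snd)).prodMk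
        ((measurable_pi_apply _).comp measurable_fst)
    -- Symmetry of one step says that the backward transition kernel is again `K`.
    have hκ : μ.map (fun ω => (X 1 ω, (σ ((path X Y 0 1 ω).2 0), (path X Y 0 1 ω).1 0))) =
        μ.map (X 1) ⊗ₘ K := by
      have h0 : μ.map (fun ω => (X 0 ω, (Y 0 ω, X 1 ω))) = μ.map (X 0) ⊗ₘ K := by
        refine Measure.ext_of_lintegral _ fun f hf => ?_
        have h1 := h.lintegral_next 0 (W := fun p => p.1 0) (by fun_prop) hf
        rw [lintegral_map hf ((h.measurable_state 0).prodMk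
          ((h.measurable_link 0).prodMk (h.measurable_state 1))), Measure.lintegral_compProd hf,
          lintegral_map (Measurable.lintegral_kernel_prod_right' hf) (h.measurable_state 0)]
        simpa [path] using h1
      rw [h.map_state 1, ← h0, ← hsymm]
      simp [path]
    refine Measure.ext_of_lintegral _ fun f hf => ?_
    have he : Measurable fun q : ((Fin (T + 1) → α) × (Fin T → β)) × (β × α) =>
        f (extend (reversePath σ q.1) q.2) :=
      hf.comp (measurable_extend.comp (((hr T).comp measurable_fst).prodMk measurable_snd))
    have h1 := h.lintegral_path 1 hW hκ T he
    have hlast : ∀ ω, X 1 ω = (reversePath σ (path X Y 1 T ω)).1 (Fin.last T) := fun ω => by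
      simp [path, reversePath]
    have he2 : Measurable fun q : ((Fin (T + 1) → α) × (Fin T → β)) × (β × α) =>
      f (extend q.1 q.2) := hf.comp measurable_extend
    let K' : Kernel ((Fin (T + 1) → α) × (Fin T → β)) (β × α) :=
      K.comap (fun p => p.1 (Fin.last T)) (by fun_prop)
    have hK' : Measurable fun p : (Fin (T + 1) → α) × (Fin T → β) =>
        ∫⁻ z, f (extend p z) ∂K (p.1 (Fin.last T)) :=
      Measurable.lintegral_kernel_prod_right' (κ := K') he2
    have hfirst : ∀ ω, (path X Y 0 1 ω).1 0 = X 0 ω := fun ω => by simp [path]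
    have hlink : ∀ ω, (path X Y 0 1 ω).2 0 = Y 0 ω := fun ω => by simp [path]
    simp only [hfirst, hlink, hlast] at h1
    have hrp : Measurable fun ω => reversePath σ (path X Y 0 (T + 1) ω) :=
      (hr (T + 1)).comp (hp 0 (T + 1))
    have hrp1 : Measurable fun ω => reversePath σ (path X Y 1 T ω) := (hr T).comp (hp 1 T)
    -- By stationarity and the induction hypothesis the reversed path from time `1` has the forward
    -- law; appending a `K`-step yields the forward law one step longer.
    have hmap : μ.map (fun ω => reversePath σ (path X Y 1 T ω)) = μ.map (path X Y 0 T) := by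
      rw [← ih]
      have e : ∀ t, μ.map (fun ω => reversePath σ (path X Y t T ω)) =
          (μ.map (path X Y t T)).map (reversePath σ) := fun t =>
        (Measure.map_map (hr T) (hp t T)).symm
      rw [e, e, h.map_path]
    rw [lintegral_map hf hrp]
    simp only [reversePath_path_succ, Nat.zero_add, h1]
    rw [← lintegral_map hK' hrp1, hmap, h.map_path_succ,
      lintegral_map hf measurable_extend, Measure.lintegral_compProd he2]
    rfl

/-- A function of the past that is independent of the present is independent of the future. -/
theorem indepFun_future (h : IsStationaryChain μ X Y K) (t : ℕ)
    {W : (Fin (t + 1) → α) × (Fin t → β) → γ} (hW : Measurable W)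
    (hind : IndepFun (fun ω => W (path X Y 0 t ω)) (X t) μ) :
    IndepFun (fun ω => W (path X Y 0 t ω))
      (fun ω => fun s : ℕ => (X (t + s) ω, Y (t + s) ω)) μ := by
  have hp := measurable_path h.measurable_state h.measurable_link
  have hWm : Measurable fun ω => W (path X Y 0 t ω) := hW.comp (hp 0 t)
  have : IsProbabilityMeasure (μ.map fun ω => W (path X Y 0 t ω)) :=
    Measure.isProbabilityMeasure_map hWm.aemeasurable
  -- Independence of the present means that the conditional law is a constant kernel.
  have hκ : μ.map (fun ω => (X t ω, W (path X Y 0 t ω))) =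
      μ.map (X t) ⊗ₘ Kernel.const _ (μ.map fun ω => W (path X Y 0 t ω)) := by
    rw [Measure.compProd_const]
    exact (indepFun_iff_map_prod_eq_prod_map_map (h.measurable_state t).aemeasurable
      hWm.aemeasurable).1 hind.symm
  have hpath : ∀ s, IndepFun (fun ω => W (path X Y 0 t ω)) (path X Y t s) μ := fun s => by
    refine IndepFun.symm ((indepFun_iff_map_prod_eq_prod_map_map (hp t s).aemeasurable
      hWm.aemeasurable).2 ?_)
    refine Measure.ext_of_lintegral _ fun f hf => ?_
    rw [lintegral_map hf ((hp t s).prodMk hWm), h.lintegral_path t hW hκ s hf,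
      lintegral_prod _ hf.aemeasurable, lintegral_map hf.lintegral_prod_right' (hp t s)]
    simp
  refine IndepFun.indepFun_process hWm
    (fun s => (h.measurable_state _).prodMk (h.measurable_link _)) fun J => ?_
  -- Finitely many times suffice. A path of length `s` carries only the links before `s`, so
  -- reaching the link at `J.sup id` takes length `J.sup id + 1`.
  let g : (Fin (J.sup id + 1 + 1) → α) × (Fin (J.sup id + 1) → β) → J → α × β := fun p s =>
    (p.1 ⟨s, by have := Finset.le_sup (f := id) s.2; simp at this; omega⟩,
      p.2 ⟨s, by have := Finset.le_sup (f := id) s.2; simp at this; omega⟩)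
  have hg : Measurable g := by
    refine measurable_pi_lambda _ fun s => ?_
    fun_prop
  exact (hpath (J.sup id + 1)).comp measurable_id hg

end IsStationaryChain

end Markov

/-! ### The one-step law and the identification of its off-diagonal scale -/

section Law

variable {q : ℕ}

/-- The blockwise factorization of the inverse Wishart law with equal diagonal scale blocks. -/
theorem map_schur_augmented {n : ℝ} (hn : 0 < n) {S : Matrix (Fin q) (Fin q) ℝ} (hS : S.PosDef)
    (G : Matrix (Fin q) (Fin q) ℝ)
    (h : IsProbabilityMeasure (invWishart (n + 2) (n • Matrix.fromBlocks S G Gᵀ S))) :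
    IsMarkovKernel (normalKernel (ι := Fin q) (G * S⁻¹) (n • S)⁻¹) ∧
    IsProbabilityMeasure (invWishart (n + q + 2) (n • (S - G * S⁻¹ * Gᵀ))) ∧
    IsProbabilityMeasure (invWishart (n + 2) (n • S)) ∧
    (invWishart (n + 2) (n • Matrix.fromBlocks S G Gᵀ S)).map schur =
      ((invWishart (n + q + 2) (n • (S - G * S⁻¹ * Gᵀ))) ⊗ₘ
        normalKernel (G * S⁻¹) (n • S)⁻¹).prod (invWishart (n + 2) (n • S)) := by
  have hnS : (n • S).PosDef := hS.smul hn
  have hinv : (n • S)⁻¹ = n⁻¹ • S⁻¹ := by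
    have := invertibleOfNonzero hn.ne'
    rw [Matrix.inv_smul _ _ hS.det_pos.ne'.isUnit, invOf_eq_inv]
  have hM : n • G * (n • S)⁻¹ = G * S⁻¹ := by
    rw [hinv, Matrix.smul_mul, Matrix.mul_smul, smul_smul, mul_inv_cancel₀ hn.ne', one_smul]
  have hV : n • S - n • G * (n • S)⁻¹ * (n • G)ᵀ = n • (S - G * S⁻¹ * Gᵀ) := by
    rw [hM, Matrix.transpose_smul, Matrix.mul_smul, smul_sub]
  have hδ : n + 2 + (Fintype.card (Fin q) : ℝ) = n + q + 2 := by
    rw [Fintype.card_fin]; ring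
  rw [Matrix.fromBlocks_smul, ← Matrix.transpose_smul] at h ⊢
  obtain ⟨⟨h0, h1⟩, h2, h3⟩ := masses_of_isProbabilityMeasure_invWishart _ _ _ hnS h
  have key := map_schur_invWishart _ _ _ hnS h
  rw [hV, hδ] at h3
  rw [hV, hM, hδ] at key
  exact ⟨isMarkovKernel_normalKernel _ h0 h1, h3, h2, key⟩

/-- Equal laws have equal laws of the Schur complement, hence kernels for the regression matrix that
agree almost surely. At a single positive definite `ψ` where they agree, the means can be compared.
-/
theorem regression_eq_of_invWishart_eq {n : ℝ} (hn : 0 < n) {S : Matrix (Fin q) (Fin q) ℝ}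
    (hS : S.PosDef) {G₁ G₂ : Matrix (Fin q) (Fin q) ℝ}
    (h : IsProbabilityMeasure (invWishart (n + 2) (n • Matrix.fromBlocks S G₁ G₁ᵀ S)))
    (heq : invWishart (n + 2) (n • Matrix.fromBlocks S G₁ G₁ᵀ S) =
      invWishart (n + 2) (n • Matrix.fromBlocks S G₂ G₂ᵀ S)) : G₁ * S⁻¹ = G₂ * S⁻¹ := by
  obtain ⟨hk₁, hΨ₁, hS₁, h₁⟩ := map_schur_augmented hn hS G₁ h
  obtain ⟨hk₂, hΨ₂, hS₂, h₂⟩ := map_schur_augmented hn hS G₂ (heq ▸ h)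
  rw [heq, h₂] at h₁
  have hc := congrArg Measure.fst h₁
  rw [Measure.fst_prod, Measure.fst_prod] at hc
  have hΨ := congrArg Measure.fst hc
  rw [Measure.fst_compProd, Measure.fst_compProd] at hΨ
  rw [hΨ] at hc
  have hae := Kernel.ae_eq_of_compProd_eq hc
  obtain ⟨ψ, hψ, hψpos⟩ := (hae.and (ae_posDef_invWishart _ _)).exists
  rw [normalKernel_apply _ _ hψpos, normalKernel_apply _ _ hψpos] at hψ
  refine matrixNormal_mean_injective hψpos (hS.smul hn).inv ?_ hψ.symm
  rw [← normalKernel_apply _ _ hψpos]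
  exact hk₁.isProbabilityMeasure ψ

theorem map_swap_augmented (n : ℝ) (S G : Matrix (Fin q) (Fin q) ℝ) :
    (invWishart (n + 2) (n • Matrix.fromBlocks S G Gᵀ S)).map
      (fun Z => Z.submatrix Sum.swap Sum.swap) =
      invWishart (n + 2) (n • Matrix.fromBlocks S Gᵀ G S) := by
  have h := map_submatrix_invWishart (n + 2) (n • Matrix.fromBlocks S G Gᵀ S)
    (Equiv.sumComm (Fin q) (Fin q))
  rw [Matrix.submatrix_smul, Pi.smul_apply, Pi.smul_apply, Equiv.sumComm_apply,
    Matrix.fromBlocks_submatrix_sum_swap_sum_swap] at h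
  exact h

end Law

/-! ### The IW-AR(1) process in reverse time -/

section IWProcess

variable {Ω : Type*} [MeasurableSpace Ω] {μ : Measure Ω} [IsProbabilityMeasure μ] {q : ℕ} {n : ℝ}
  {S F : Matrix (Fin q) (Fin q) ℝ} {Sig φ : ℕ → Ω → Matrix (Fin q) (Fin q) ℝ}

/-- The augmented matrix of consecutive states. -/
def augmented (Sig φ : ℕ → Ω → Matrix (Fin q) (Fin q) ℝ) (t : ℕ) (ω : Ω) :
    Matrix (Fin q ⊕ Fin q) (Fin q ⊕ Fin q) ℝ :=
  Matrix.fromBlocks (Sig t ω) (φ t ω)ᵀ (φ t ω) (Sig (t + 1) ω)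

/-- The blocks of an augmented matrix. -/
def unaugment (Z : Matrix (Fin q ⊕ Fin q) (Fin q ⊕ Fin q) ℝ) :
    Matrix (Fin q) (Fin q) ℝ × (Matrix (Fin q) (Fin q) ℝ × Matrix (Fin q) (Fin q) ℝ) :=
  (Z.toBlocks₁₁, (Z.toBlocks₂₁, Z.toBlocks₂₂))

theorem measurable_unaugment : Measurable (unaugment (q := q)) := by
  have h11 : Measurable fun Z : Matrix (Fin q ⊕ Fin q) (Fin q ⊕ Fin q) ℝ => Z.toBlocks₁₁ :=
    measurable_id.matrix_submatrix Sum.inl Sum.inl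
  have h21 : Measurable fun Z : Matrix (Fin q ⊕ Fin q) (Fin q ⊕ Fin q) ℝ => Z.toBlocks₂₁ :=
    measurable_id.matrix_submatrix Sum.inr Sum.inl
  have h22 : Measurable fun Z : Matrix (Fin q ⊕ Fin q) (Fin q ⊕ Fin q) ℝ => Z.toBlocks₂₂ :=
    measurable_id.matrix_submatrix Sum.inr Sum.inr
  exact h11.prodMk (h21.prodMk h22)

theorem measurable_fromBlocks {α : Type*} [MeasurableSpace α]
    {A B C D : α → Matrix (Fin q) (Fin q) ℝ} (hA : Measurable A) (hB : Measurable B)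
    (hC : Measurable C) (hD : Measurable D) :
    Measurable fun a => Matrix.fromBlocks (A a) (B a) (C a) (D a) := by
  refine measurable_matrix_iff.2 ?_
  rintro (i | i) (j | j)
  · exact measurable_matrix_iff.1 hA i j
  · exact measurable_matrix_iff.1 hB i j
  · exact measurable_matrix_iff.1 hC i j
  · exact measurable_matrix_iff.1 hD i j

namespace IsIWAR

theorem measurable_augmented (h : IsIWAR n S F μ Sig φ) (t : ℕ) :
    Measurable (augmented Sig φ t) :=
  measurable_fromBlocks (h.measurable_state t) (h.measurable_latent t).matrix_transpose
    (h.measurable_latent t) (h.measurable_state (t + 1))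

theorem map_augmented (h : IsIWAR n S F μ Sig φ) (hS : S.PosDef) (t : ℕ) :
    μ.map (augmented Sig φ t) =
      invWishart (n + 2) (n • Matrix.fromBlocks S (S * Fᵀ) (S * Fᵀ)ᵀ S) := by
  rw [Matrix.transpose_mul, Matrix.transpose_transpose, transpose_eq_of_posDef hS]
  exact h.joint_law t

theorem isProbabilityMeasure_invWishart (h : IsIWAR n S F μ Sig φ) (hS : S.PosDef) :
    IsProbabilityMeasure (invWishart (n + 2) (n • Matrix.fromBlocks S (S * Fᵀ) (S * Fᵀ)ᵀ S)) := by
  rw [← h.map_augmented hS 0]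
  exact Measure.isProbabilityMeasure_map (h.measurable_augmented 0).aemeasurable

theorem map_triple (h : IsIWAR n S F μ Sig φ) (t : ℕ) :
    μ.map (fun ω => (Sig t ω, (φ t ω, Sig (t + 1) ω))) =
      μ.map (fun ω => (Sig 0 ω, (φ 0 ω, Sig 1 ω))) := by
  have e : ∀ t, μ.map (fun ω => (Sig t ω, (φ t ω, Sig (t + 1) ω))) =
      (invWishart (n + 2) (n • Matrix.fromBlocks S (S * Fᵀ) (F * S) S)).map unaugment := fun t => by
    rw [← h.joint_law t]
    exact (Measure.map_map measurable_unaugment (h.measurable_augmented t)).symm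
  rw [e t, ← e 0]

/-- The triples of state, link and next state are identically distributed, so the transition kernel
at time `0` is a version of the one at every time. -/
theorem isStationaryChain (h : IsIWAR n S F μ Sig φ) :
    IsStationaryChain μ Sig φ (condDistrib (fun ω => (φ 0 ω, Sig 1 ω)) (Sig 0) μ) := by
  have hS := h.measurable_state
  have hφ := h.measurable_latent
  have hnext : ∀ t, Measurable fun ω => (φ t ω, Sig (t + 1) ω) := fun t =>
    (hφ t).prodMk (hS (t + 1))
  have hstate : ∀ t, μ.map (Sig t) = μ.map (Sig 0) := fun t => by
    have := congrArg Measure.fst (h.map_triple t)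
    rwa [Measure.fst_map_prodMk (hnext t), Measure.fst_map_prodMk (hnext 0)] at this
  refine ⟨hS, hφ, hstate, fun t => ?_⟩
  have hpast : (fun ω => ((fun s : Fin (t + 1) => Sig s ω), (fun s : Fin t => φ s ω))) =
      path Sig φ 0 t := by
    funext ω
    simp [path]
  have hp := measurable_path hS hφ 0 t
  have hκ : condDistrib (fun ω => (φ t ω, Sig (t + 1) ω)) (Sig t) μ =ᵐ[μ.map (Sig t)]
      condDistrib (fun ω => (φ 0 ω, Sig 1 ω)) (Sig 0) μ := by
    refine condDistrib_ae_eq_of_measure_eq_compProd _ (hnext t).aemeasurable ?_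
    rw [h.map_triple t, hstate t, compProd_map_condDistrib (hnext 0).aemeasurable]
  have hm := h.markov t
  simp only [hpast] at hm
  rw [← compProd_map_condDistrib (hnext t).aemeasurable]
  refine Measure.compProd_congr ?_
  have hlast : Measurable fun p : (Fin (t + 1) → Matrix (Fin q) (Fin q) ℝ) ×
      (Fin t → Matrix (Fin q) (Fin q) ℝ) => p.1 (Fin.last t) := by fun_prop
  have hmap : μ.map (Sig t) = (μ.map (path Sig φ 0 t)).map fun p => p.1 (Fin.last t) := by
    rw [Measure.map_map hlast hp]
    congr 1
    funext ω
    simp [path]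
  rw [hmap] at hκ
  filter_upwards [hm, ae_of_ae_map hlast.aemeasurable hκ] with p h1 h2
  rw [h1, h2, Kernel.comap_apply]

/-- The reverse-time regression matrix of consecutive states. -/
def revΥ (Sig φ : ℕ → Ω → Matrix (Fin q) (Fin q) ℝ) (t : ℕ) (ω : Ω) : Matrix (Fin q) (Fin q) ℝ :=
  (φ t ω)ᵀ * (Sig (t + 1) ω)⁻¹

/-- The reverse-time innovation of consecutive states. -/
def revΨ (Sig φ : ℕ → Ω → Matrix (Fin q) (Fin q) ℝ) (t : ℕ) (ω : Ω) : Matrix (Fin q) (Fin q) ℝ :=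
  Sig t ω - (φ t ω)ᵀ * (Sig (t + 1) ω)⁻¹ * φ t ω

omit [MeasurableSpace Ω] in
theorem schur_augmented (t : ℕ) (ω : Ω) :
    schur (augmented Sig φ t ω) = ((revΨ Sig φ t ω, revΥ Sig φ t ω), Sig (t + 1) ω) := by
  simp [schur, augmented, revΨ, revΥ]

theorem measurable_revΥ (h : IsIWAR n S F μ Sig φ) (t : ℕ) : Measurable (revΥ Sig φ t) :=
  (h.measurable_latent t).matrix_transpose.matrix_mul
    (measurable_matrix_inv.comp (h.measurable_state (t + 1)))

theorem measurable_revΨ (h : IsIWAR n S F μ Sig φ) (t : ℕ) : Measurable (revΨ Sig φ t) :=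
  (h.measurable_state t).matrix_sub ((h.measurable_revΥ t).matrix_mul (h.measurable_latent t))

theorem revV_eq (hS : S.PosDef) : revV S F = S - S * Fᵀ * S⁻¹ * (S * Fᵀ)ᵀ := by
  rw [revV, Matrix.transpose_mul, Matrix.transpose_transpose, transpose_eq_of_posDef hS,
    ← Matrix.mul_assoc]

theorem isMarkovKernel (h : IsIWAR n S F μ Sig φ) (hn : 0 < n) (hS : S.PosDef) :
    IsMarkovKernel (normalKernel (ι := Fin q) (revF S F) (n • S)⁻¹) :=
  (map_schur_augmented hn hS _ (h.isProbabilityMeasure_invWishart hS)).1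

theorem isProbabilityMeasure_innovation (h : IsIWAR n S F μ Sig φ) (hn : 0 < n) (hS : S.PosDef) :
    IsProbabilityMeasure (invWishart (n + q + 2) (n • revV S F)) := by
  rw [revV_eq hS]
  exact (map_schur_augmented hn hS _ (h.isProbabilityMeasure_invWishart hS)).2.1

theorem isProbabilityMeasure_state (h : IsIWAR n S F μ Sig φ) (hn : 0 < n) (hS : S.PosDef) :
    IsProbabilityMeasure (invWishart (n + 2) (n • S)) :=
  (map_schur_augmented hn hS _ (h.isProbabilityMeasure_invWishart hS)).2.2.1

theorem map_innovation_state (h : IsIWAR n S F μ Sig φ) (hn : 0 < n) (hS : S.PosDef) (t : ℕ) :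
    μ.map (fun ω => ((revΨ Sig φ t ω, revΥ Sig φ t ω), Sig (t + 1) ω)) =
      ((invWishart (n + q + 2) (n • revV S F)) ⊗ₘ normalKernel (revF S F) (n • S)⁻¹).prod
        (invWishart (n + 2) (n • S)) := by
  have h1 := (map_schur_augmented hn hS _ (h.isProbabilityMeasure_invWishart hS)).2.2.2
  rw [← h.map_augmented hS t, Measure.map_map measurable_schur (h.measurable_augmented t)] at h1
  rw [revV_eq hS, revF, ← h1]
  simp only [Function.comp_def, schur_augmented]

theorem map_innovation (h : IsIWAR n S F μ Sig φ) (hn : 0 < n) (hS : S.PosDef) (t : ℕ) :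
    μ.map (fun ω => (revΨ Sig φ t ω, revΥ Sig φ t ω)) =
      (invWishart (n + q + 2) (n • revV S F)) ⊗ₘ normalKernel (revF S F) (n • S)⁻¹ := by
  have := h.isMarkovKernel hn hS
  have := h.isProbabilityMeasure_innovation hn hS
  have := h.isProbabilityMeasure_state hn hS
  have h1 := congrArg Measure.fst (h.map_innovation_state hn hS t)
  rwa [Measure.fst_map_prodMk (h.measurable_state (t + 1)), Measure.fst_prod] at h1

theorem map_state_succ (h : IsIWAR n S F μ Sig φ) (hn : 0 < n) (hS : S.PosDef) (t : ℕ) :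
    μ.map (Sig (t + 1)) = invWishart (n + 2) (n • S) := by
  have := h.isMarkovKernel hn hS
  have := h.isProbabilityMeasure_innovation hn hS
  have := h.isProbabilityMeasure_state hn hS
  have h1 := congrArg Measure.snd (h.map_innovation_state hn hS t)
  rwa [Measure.snd_map_prodMk ((h.measurable_revΨ t).prodMk (h.measurable_revΥ t)),
    Measure.snd_prod] at h1

theorem ae_posDef (h : IsIWAR n S F μ Sig φ) (hn : 0 < n) (hS : S.PosDef) (t : ℕ) :
    ∀ᵐ ω ∂μ, (Sig (t + 1) ω).PosDef := by
  refine ae_of_ae_map (h.measurable_state (t + 1)).aemeasurable ?_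
  rw [h.map_state_succ hn hS]
  exact ae_posDef_invWishart _ _

/-- The reverse-time representation of the process. -/
theorem isReverseRecursion (h : IsIWAR n S F μ Sig φ) (hn : 0 < n) (hS : S.PosDef) :
    IsReverseRecursion n S (revF S F) (revV S F) μ Sig φ (revΥ Sig φ) (revΨ Sig φ) := by
  have hk := h.isMarkovKernel hn hS
  have hΨ := h.isProbabilityMeasure_innovation hn hS
  have hlawΨ : ∀ t, μ.map (revΨ Sig φ t) = invWishart (n + q + 2) (n • revV S F) := fun t => by
    have h1 := congrArg Measure.fst (h.map_innovation hn hS t)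
    rwa [Measure.fst_map_prodMk (h.measurable_revΥ t), Measure.fst_compProd] at h1
  have hlatent : ∀ t, ∀ᵐ ω ∂μ, (φ t ω)ᵀ = revΥ Sig φ t ω * Sig (t + 1) ω := fun t => by
    filter_upwards [h.ae_posDef hn hS t] with ω hω
    rw [revΥ, Matrix.nonsing_inv_mul_cancel_right _ _ hω.det_pos.ne'.isUnit]
  refine ⟨h.measurable_revΥ, h.measurable_revΨ, hlatent, fun t => ?_, hlawΨ, fun t => ?_,
    fun t => ?_⟩
  · filter_upwards [h.ae_posDef hn hS t, hlatent t] with ω hω hl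
    rw [← hl, revΥ, Matrix.transpose_mul, Matrix.transpose_nonsing_inv,
      transpose_eq_of_posDef hω, Matrix.transpose_transpose, ← Matrix.mul_assoc, revΨ,
      sub_add_cancel]
  · have h1 : condDistrib (revΥ Sig φ t) (revΨ Sig φ t) μ =ᵐ[μ.map (revΨ Sig φ t)]
        normalKernel (revF S F) (n • S)⁻¹ := by
      refine condDistrib_ae_eq_of_measure_eq_compProd _ (h.measurable_revΥ t).aemeasurable ?_
      rw [h.map_innovation hn hS, hlawΨ]
    have h2 : ∀ᵐ ψ ∂μ.map (revΨ Sig φ t), ψ.PosDef := by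
      rw [hlawΨ]
      exact ae_posDef_invWishart _ _
    filter_upwards [h1, h2] with ψ hψ hpos
    rw [hψ, normalKernel_apply _ _ hpos]
  · have hind : IndepFun (fun ω => (revΨ Sig φ t ω, revΥ Sig φ t ω)) (Sig (t + 1)) μ := by
      rw [indepFun_iff_map_prod_eq_prod_map_map
        ((h.measurable_revΨ t).prodMk (h.measurable_revΥ t)).aemeasurable
        (h.measurable_state (t + 1)).aemeasurable, h.map_innovation hn hS, h.map_state_succ hn hS]
      exact h.map_innovation_state hn hS t
    -- The innovations at step `t` are functions of the path up to time `t + 1`, so they count as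
    -- past relative to `Sig (t + 1)`.
    let W : (Fin (t + 1 + 1) → Matrix (Fin q) (Fin q) ℝ) × (Fin (t + 1) → Matrix (Fin q) (Fin q) ℝ) →
        Matrix (Fin q) (Fin q) ℝ × Matrix (Fin q) (Fin q) ℝ := fun p =>
      ((p.2 (Fin.last t))ᵀ * (p.1 (Fin.last (t + 1)))⁻¹,
        p.1 (Fin.last t).castSucc -
          (p.2 (Fin.last t))ᵀ * (p.1 (Fin.last (t + 1)))⁻¹ * p.2 (Fin.last t))
    have hWp : ∀ ω, W (path Sig φ 0 (t + 1) ω) = (revΥ Sig φ t ω, revΨ Sig φ t ω) := fun ω => by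
      simp [W, path, revΥ, revΨ]
    have hW : Measurable W := by
      have hx : ∀ i, Measurable fun p : (Fin (t + 1 + 1) → Matrix (Fin q) (Fin q) ℝ) ×
          (Fin (t + 1) → Matrix (Fin q) (Fin q) ℝ) => p.1 i := fun i =>
        (measurable_pi_apply i).comp measurable_fst
      have hy : ∀ i, Measurable fun p : (Fin (t + 1 + 1) → Matrix (Fin q) (Fin q) ℝ) ×
          (Fin (t + 1) → Matrix (Fin q) (Fin q) ℝ) => p.2 i := fun i =>
        (measurable_pi_apply i).comp measurable_snd
      have hΥ := (hy (Fin.last t)).matrix_transpose.matrix_mul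
        (measurable_matrix_inv.comp (hx (Fin.last (t + 1))))
      exact hΥ.prodMk ((hx _).matrix_sub (hΥ.matrix_mul (hy _)))
    have hfut := h.isStationaryChain.indepFun_future (t + 1) hW (by
      simp only [hWp]
      exact hind.comp measurable_swap measurable_id)
    simp only [hWp] at hfut
    exact hfut

theorem unaugment_law (h : IsIWAR n S F μ Sig φ) (hS : S.PosDef) :
    μ.map (fun ω => (Sig 0 ω, (φ 0 ω, Sig 1 ω))) =
      (invWishart (n + 2) (n • Matrix.fromBlocks S (S * Fᵀ) (S * Fᵀ)ᵀ S)).map unaugment := by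
  rw [← h.map_augmented hS 0, Measure.map_map measurable_unaugment (h.measurable_augmented 0)]
  rfl

theorem map_augmented_swap (h : IsIWAR n S F μ Sig φ) (hS : S.PosDef) :
    μ.map (fun ω => Matrix.fromBlocks (Sig 1 ω) (φ 0 ω) (φ 0 ω)ᵀ (Sig 0 ω)) =
      invWishart (n + 2) (n • Matrix.fromBlocks S (S * Fᵀ)ᵀ (S * Fᵀ) S) := by
  have hsub : Measurable fun Z : Matrix (Fin q ⊕ Fin q) (Fin q ⊕ Fin q) ℝ =>
      Z.submatrix Sum.swap Sum.swap := measurable_id.matrix_submatrix _ _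
  rw [← map_swap_augmented, ← h.map_augmented hS 0,
    Measure.map_map hsub (h.measurable_augmented 0)]
  congr 1
  funext ω
  exact (Matrix.fromBlocks_submatrix_sum_swap_sum_swap _ _ _ _).symm

/-- When `S F'` is symmetric, the block swap leaves the scale matrix unchanged, so one step is
symmetric and the chain result applies. -/
theorem isTimeReversible (h : IsIWAR n S F μ Sig φ) (hS : S.PosDef) (hFS : F * S = S * Fᵀ) :
    IsTimeReversible μ Sig φ := by
  have hG : (S * Fᵀ)ᵀ = S * Fᵀ := by
    rw [Matrix.transpose_mul, Matrix.transpose_transpose, transpose_eq_of_posDef hS, hFS]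
  have hswap : Measurable fun ω => Matrix.fromBlocks (Sig 1 ω) (φ 0 ω) (φ 0 ω)ᵀ (Sig 0 ω) :=
    measurable_fromBlocks (h.measurable_state 1) (h.measurable_latent 0)
      (h.measurable_latent 0).matrix_transpose (h.measurable_state 0)
  have hsymm : μ.map (fun ω => (Sig 1 ω, ((φ 0 ω)ᵀ, Sig 0 ω))) =
      μ.map (fun ω => (Sig 0 ω, (φ 0 ω, Sig 1 ω))) := by
    have h1 := congrArg (Measure.map unaugment) (h.map_augmented_swap hS)
    rw [Measure.map_map measurable_unaugment hswap, hG] at h1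
    rw [h.unaugment_law hS, hG, ← h1]
    rfl
  intro T
  have hrev := h.isStationaryChain.map_reversePath (σ := Matrix.transpose)
    measurable_id.matrix_transpose hsymm T
  have hpath : path Sig φ 0 T = fun ω => ((fun i : Fin (T + 1) => Sig i ω), (fun i : Fin T => φ i ω)) := by
    funext ω
    simp [path]
  rw [hpath] at hrev
  exact hrev

/-- The horizon `T = 1` suffices: it equates the inverse Wishart laws with off-diagonal scales `S
F'` and its transpose, whose regression means must then coincide. -/
theorem symmetric_of_isTimeReversible (h : IsIWAR n S F μ Sig φ) (hn : 0 < n) (hS : S.PosDef)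
    (hrev : IsTimeReversible μ Sig φ) : F * S = S * Fᵀ := by
  have h1 := hrev 1
  let b : (Fin (1 + 1) → Matrix (Fin q) (Fin q) ℝ) × (Fin 1 → Matrix (Fin q) (Fin q) ℝ) →
      Matrix (Fin q ⊕ Fin q) (Fin q ⊕ Fin q) ℝ := fun p =>
    Matrix.fromBlocks (p.1 0) (p.2 0)ᵀ (p.2 0) (p.1 1)
  have hb : Measurable b := by
    have hx : ∀ i, Measurable fun p : (Fin (1 + 1) → Matrix (Fin q) (Fin q) ℝ) ×
        (Fin 1 → Matrix (Fin q) (Fin q) ℝ) => p.1 i := fun i =>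
      (measurable_pi_apply i).comp measurable_fst
    have hy : ∀ i, Measurable fun p : (Fin (1 + 1) → Matrix (Fin q) (Fin q) ℝ) ×
        (Fin 1 → Matrix (Fin q) (Fin q) ℝ) => p.2 i := fun i =>
      (measurable_pi_apply i).comp measurable_snd
    exact measurable_fromBlocks (hx 0) (hy 0).matrix_transpose (hy 0) (hx 1)
  have hm1 : Measurable fun ω => ((fun i : Fin (1 + 1) => Sig i.rev ω),
      (fun i : Fin 1 => (φ i.rev ω)ᵀ)) :=
    (measurable_pi_lambda _ fun i => h.measurable_state _).prodMk
      (measurable_pi_lambda _ fun i => (h.measurable_latent _).matrix_transpose)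
  have hm2 : Measurable fun ω => ((fun i : Fin (1 + 1) => Sig i ω), (fun i : Fin 1 => φ i ω)) :=
    (measurable_pi_lambda _ fun i => h.measurable_state _).prodMk
      (measurable_pi_lambda _ fun i => h.measurable_latent _)
  have h2 := congrArg (Measure.map b) h1
  rw [Measure.map_map hb hm1, Measure.map_map hb hm2] at h2
  have h3 : μ.map (fun ω => Matrix.fromBlocks (Sig 1 ω) (φ 0 ω) (φ 0 ω)ᵀ (Sig 0 ω)) =
      μ.map (augmented Sig φ 0) := h2
  rw [h.map_augmented_swap hS, h.map_augmented hS] at h3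
  have hprob := h.isProbabilityMeasure_invWishart hS
  have h4 := regression_eq_of_invWishart_eq hn hS (G₁ := S * Fᵀ) (G₂ := (S * Fᵀ)ᵀ) hprob
    (by rw [Matrix.transpose_transpose, h3])
  have h5 := congrArg (· * S) h4
  simp only [Matrix.nonsing_inv_mul_cancel_right _ _ hS.det_pos.ne'.isUnit] at h5
  rw [h5, Matrix.transpose_mul, Matrix.transpose_transpose, transpose_eq_of_posDef hS]

/-- The autoregressive matrix of a reverse-time representation is determined by the process. -/
theorem reverseRecursion_unique (h : IsIWAR n S F μ Sig φ) (hn : 0 < n) (hS : S.PosDef)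
    {A₁ A₂ W₁ W₂ : Matrix (Fin q) (Fin q) ℝ} {Υ₁ Υ₂ Ψ₁ Ψ₂ : ℕ → Ω → Matrix (Fin q) (Fin q) ℝ}
    (h₁ : IsReverseRecursion n S A₁ W₁ μ Sig φ Υ₁ Ψ₁)
    (h₂ : IsReverseRecursion n S A₂ W₂ μ Sig φ Υ₂ Ψ₂) : A₁ = A₂ := by
  have hΥ : Υ₁ 0 =ᵐ[μ] Υ₂ 0 := by
    filter_upwards [h₁.latent 0, h₂.latent 0, h.ae_posDef hn hS 0] with ω e₁ e₂ hω
    have e := congrArg (· * (Sig (0 + 1) ω)⁻¹) (e₁.symm.trans e₂)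
    simpa only [Matrix.mul_nonsing_inv_cancel_right _ _ hω.det_pos.ne'.isUnit] using e
  have hΨ : Ψ₁ 0 =ᵐ[μ] Ψ₂ 0 := by
    filter_upwards [h₁.recursion 0, h₂.recursion 0, hΥ] with ω e₁ e₂ e
    rw [e₁, e] at e₂
    exact add_right_cancel e₂
  have l₁ := h₁.law_Υ 0
  rw [condDistrib_congr hΥ hΨ, Measure.map_congr hΨ] at l₁
  have hpos : ∀ᵐ ψ ∂μ.map (Ψ₂ 0), ψ.PosDef := by
    rw [h₂.law_Ψ]
    exact ae_posDef_invWishart _ _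
  have : IsProbabilityMeasure (μ.map (Ψ₂ 0)) :=
    Measure.isProbabilityMeasure_map (h₂.measurable_Ψ 0).aemeasurable
  -- With the innovations identified, both normal laws are versions of one conditional law, so a
  -- single `ψ` decides the mean; the scales `W₁` and `W₂` need not be compared.
  obtain ⟨ψ, ⟨e₁, e₂⟩, hψ⟩ := ((l₁.and (h₂.law_Υ 0)).and hpos).exists
  refine matrixNormal_mean_injective hψ (hS.smul hn).inv ?_ (e₁.symm.trans e₂)
  have hprob : IsProbabilityMeasure (condDistrib (Υ₂ 0) (Ψ₂ 0) μ ψ) := inferInstance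
  rw [e₁] at hprob
  exact hprob

end IsIWAR

omit [IsProbabilityMeasure μ] in
theorem IsTimeReversible.isStateReversible (h : IsTimeReversible μ Sig φ)
    (hφ : ∀ t, Measurable (φ t)) : IsStateReversible μ Sig := by
  intro T
  have h1 := congrArg Measure.fst (h T)
  rwa [Measure.fst_map_prodMk (measurable_pi_lambda _ fun i => (hφ _).matrix_transpose),
    Measure.fst_map_prodMk (measurable_pi_lambda _ fun i => hφ _)] at h1

theorem revF_eq_self_iff (hS : S.PosDef) : revF S F = F ↔ F * S = S * Fᵀ := by
  have hu := hS.det_pos.ne'.isUnit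
  constructor
  · intro h
    rw [← Matrix.nonsing_inv_mul_cancel_right (S) (S * Fᵀ) hu]
    exact congrArg (· * S) h.symm
  · intro h
    rw [revF, ← h, Matrix.mul_nonsing_inv_cancel_right _ _ hu]

theorem revV_eq_of_symmetric (hS : S.PosDef) (h : F * S = S * Fᵀ) :
    revV S F = S - F * S * Fᵀ := by
  rw [revV, ← h, Matrix.mul_nonsing_inv_cancel_right _ _ hS.det_pos.ne'.isUnit,
    Matrix.mul_assoc, h, ← Matrix.mul_assoc, h]

end IWProcess

end IWAR

end

theorem theorem2 {Ω : Type*} [MeasurableSpace Ω] (μ : Measure Ω) [IsProbabilityMeasure μ]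
    {q : ℕ} (n : ℝ) (hn : 0 < n) (S F : Matrix (Fin q) (Fin q) ℝ)
    (hS : S.PosDef) (hV : (S - F * S * Fᵀ).PosDef)
    (Sig φ : ℕ → Ω → Matrix (Fin q) (Fin q) ℝ) (h : IWAR.IsIWAR n S F μ Sig φ) :
    (∃ Υ Ψ : ℕ → Ω → Matrix (Fin q) (Fin q) ℝ,
      IWAR.IsReverseRecursion n S (IWAR.revF S F) (IWAR.revV S F) μ Sig φ Υ Ψ) ∧
    ((IWAR.revF S F = F ∧ IWAR.revV S F = S - F * S * Fᵀ) ↔ F * S = S * Fᵀ) ∧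
    ((∃ Υ Ψ : ℕ → Ω → Matrix (Fin q) (Fin q) ℝ,
      IWAR.IsReverseRecursion n S F (S - F * S * Fᵀ) μ Sig φ Υ Ψ) ↔ F * S = S * Fᵀ) ∧
    (IWAR.IsTimeReversible μ Sig φ ↔ F * S = S * Fᵀ) ∧
    (F * S = S * Fᵀ → IWAR.IsStateReversible μ Sig) := by
  have hrec := h.isReverseRecursion hn hS
  refine ⟨⟨_, _, hrec⟩, ⟨fun hFV => (IWAR.revF_eq_self_iff hS).1 hFV.1, fun hFS =>
    ⟨(IWAR.revF_eq_self_iff hS).2 hFS, IWAR.revV_eq_of_symmetric hS hFS⟩⟩, ⟨?_, fun hFS => ?_⟩,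
    ⟨h.symmetric_of_isTimeReversible hn hS, h.isTimeReversible hS⟩, fun hFS =>
    (h.isTimeReversible hS hFS).isStateReversible h.measurable_latent⟩
  · rintro ⟨Υ, Ψ, hΥΨ⟩
    -- The given recursion is compared with the one that always exists, whose autoregressive matrix
    -- is `revF S F`.
    exact (IWAR.revF_eq_self_iff hS).1 (h.reverseRecursion_unique hn hS hrec hΥΨ)
  · rw [(IWAR.revF_eq_self_iff hS).2 hFS, IWAR.revV_eq_of_symmetric hS hFS] at hrec
    exact ⟨_, _, hrec⟩
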